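/- Let $n\ge 1$ and let $V$ be an $n$-dimensional real vector space with a positive definite inner product. Equip $\operatorname{End}(V)$ with the Frobenius inner product $\langle a,b\rangle=\operatorname{tr}(a^t b)$, where $a^t$ denotes the adjoint of $a$, and extend it to a symmetric $\mathbb C$-bilinear form on $\operatorname{End}_{\mathbb C}(V_{\mathbb C})$, where $V_{\mathbb C}=\mathbb C\otimes_{\mathbb R}V$. For a Zariski-closed subgroup $G$ of the real algebraic group $\operatorname{GL}(V)$ let $G_{\mathbb C}\subseteq \operatorname{GL}_{\mathbb C}(V_{\mathbb C})$ be its set of complex points, that is, the invertible complex linear maps at which every real polynomial in the matrix entries that vanishes on $G$ vanishes. For $u\in\operatorname{End}(V)$, a complex critical point on $G$ of the squared distance function $d_u(x)=\|u-x\|^2$ is a point $x\in G_{\mathbb C}$ such that $\langle u-x,a\rangle=0$ for all $a$ in the tangent space $T_xG_{\mathbb C}$. The Euclidean distance degree (ED degree) of $G$ is the number of complex critical points of $d_u$ on $G$ for general $u$, that is, for all $u\in\operatorname{End}(V)$ outside some proper Zariski-closed subset. Theorem. The ED degree of $\operatorname{SL}^{\pm}(V)=\{x\in\operatorname{End}(V)\mid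 \det x=\pm1\}$ equals $n2^n$, and the ED degree of $\operatorname{SL}(V)=\{x\in\operatorname{End}(V)\mid\det x=1\}$ equals $n2^{n-1}$. -/

import Mathlib

open scoped TensorProduct

noncomputable section

namespace EDDegree

variable {V : Type*} [NormedAddCommGroup V] [InnerProductSpace ℝ V]
variable {ι : Type*} [Fintype ι] [DecidableEq ι]

/-- The matrix of a real linear map `V → V` with respect to an orthonormal basis. -/
def realMatrix (b : OrthonormalBasis ι ℝ V) (x : Module.End ℝ V) : Matrix ι ι ℝ :=
  LinearMap.toMatrix b.toBasis b.toBasis x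

/-- The matrix of a complex linear map `V_ℂ → V_ℂ`, where `V_ℂ = ℂ ⊗ V`, with respect to the
basis `1 ⊗ b i` of `V_ℂ`. -/
def complexMatrix (b : OrthonormalBasis ι ℝ V) (x : Module.End ℂ (ℂ ⊗[ℝ] V)) : Matrix ι ι ℂ :=
  LinearMap.toMatrix (b.toBasis.baseChange ℂ) (b.toBasis.baseChange ℂ) x

/-- The value of a real polynomial in the matrix entries at a real linear map. -/
def realEval (b : OrthonormalBasis ι ℝ V) (p : MvPolynomial (ι × ι) ℝ)
    (x : Module.End ℝ V) : ℝ :=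
  MvPolynomial.eval (fun ij => realMatrix b x ij.1 ij.2) p

/-- The value of a real polynomial in the matrix entries at a complex linear map. -/
def complexEval (b : OrthonormalBasis ι ℝ V) (p : MvPolynomial (ι × ι) ℝ)
    (x : Module.End ℂ (ℂ ⊗[ℝ] V)) : ℂ :=
  MvPolynomial.aeval (fun ij => complexMatrix b x ij.1 ij.2) p

/-- The symmetric `ℂ`-bilinear (not Hermitian) extension to `End_ℂ(V_ℂ)` of the Frobenius inner
product `⟨a, c⟩ = tr(aᵗ c)` on `End(V)`. -/
def frobeniusForm (b : OrthonormalBasis ι ℝ V) (a c : Module.End ℂ (ℂ ⊗[ℝ] V)) : ℂ :=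
  ((complexMatrix b a).transpose * complexMatrix b c).trace

/-- The real polynomials in the matrix entries that vanish on `G`. -/
def vanishing (b : OrthonormalBasis ι ℝ V) (G : Subgroup (LinearMap.GeneralLinearGroup ℝ V)) :
    Set (MvPolynomial (ι × ι) ℝ) :=
  {p | ∀ g ∈ G, realEval b p (g : Module.End ℝ V) = 0}

/-- The set `G_ℂ ⊆ GL_ℂ(V_ℂ) ⊆ End_ℂ(V_ℂ)` of complex points of the real algebraic group `G`. -/
def complexPoints (b : OrthonormalBasis ι ℝ V)
    (G : Subgroup (LinearMap.GeneralLinearGroup ℝ V)) : Set (Module.End ℂ (ℂ ⊗[ℝ] V)) :=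
  {x | IsUnit x ∧ ∀ p ∈ vanishing b G, complexEval b p x = 0}

/-- The (Zariski) tangent space of `G_ℂ` at the point `x`: the vectors along which the
differentials at `x` of all polynomials vanishing on `G` are zero. -/
def tangentSpace (b : OrthonormalBasis ι ℝ V)
    (G : Subgroup (LinearMap.GeneralLinearGroup ℝ V)) (x : Module.End ℂ (ℂ ⊗[ℝ] V)) :
    Set (Module.End ℂ (ℂ ⊗[ℝ] V)) :=
  {a | ∀ p ∈ vanishing b G, deriv (fun t : ℂ => complexEval b p (x + t • a)) 0 = 0}

/-- The complex critical points on `G` of the squared distance `d_u(x) = ‖u - x‖²` to the real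
data point `u`: the `x ∈ G_ℂ` such that `u - x` is orthogonal to the tangent space at `x`. -/
def criticalPoints (b : OrthonormalBasis ι ℝ V)
    (G : Subgroup (LinearMap.GeneralLinearGroup ℝ V)) (u : Module.End ℝ V) :
    Set (Module.End ℂ (ℂ ⊗[ℝ] V)) :=
  {x | x ∈ complexPoints b G ∧
    ∀ a ∈ tangentSpace b G x, frobeniusForm b (u.baseChange ℂ - x) a = 0}

/-- `N` is the Euclidean distance degree of the real algebraic group `G`: for all `u ∈ End(V)`
outside some proper Zariski-closed subset, `d_u` has exactly `N` complex critical points on `G`. -/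
def IsEDDegree (b : OrthonormalBasis ι ℝ V)
    (G : Subgroup (LinearMap.GeneralLinearGroup ℝ V)) (N : ℕ) : Prop :=
  ∃ P : MvPolynomial (ι × ι) ℝ, P ≠ 0 ∧
    ∀ u : Module.End ℝ V, realEval b P u ≠ 0 → (criticalPoints b G u).encard = N

variable (V) in
/-- The group `SL(V) = {x | det x = 1}`. -/
def SL : Subgroup (LinearMap.GeneralLinearGroup ℝ V) where
  carrier := {g | LinearMap.det (g : Module.End ℝ V) = 1}
  one_mem' := by simp
  mul_mem' := by
    intro g h hg hh
    simp only [Set.mem_ofPred_eq, Units.val_mul, map_mul] at *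
    rw [hg, hh, one_mul]
  inv_mem' := by
    intro g hg
    have h : LinearMap.det (g : Module.End ℝ V) *
        LinearMap.det ((g⁻¹ : LinearMap.GeneralLinearGroup ℝ V) : Module.End ℝ V) = 1 := by
      rw [← map_mul, Units.mul_inv, map_one]
    simp only [Set.mem_ofPred_eq] at *
    rwa [hg, one_mul] at h

variable (V) in
/-- The group `SL^±(V) = {x | det x = ±1}`. -/
def SLpm : Subgroup (LinearMap.GeneralLinearGroup ℝ V) where
  carrier := {g | LinearMap.det (g : Module.End ℝ V) = 1 ∨
    LinearMap.det (g : Module.End ℝ V) = -1}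
  one_mem' := by simp
  mul_mem' := by
    intro g h hg hh
    simp only [Set.mem_ofPred_eq, Units.val_mul, map_mul] at *
    rcases hg with hg | hg <;> rcases hh with hh | hh <;> simp [hg, hh]
  inv_mem' := by
    intro g hg
    have h : LinearMap.det (g : Module.End ℝ V) *
        LinearMap.det ((g⁻¹ : LinearMap.GeneralLinearGroup ℝ V) : Module.End ℝ V) = 1 := by
      rw [← map_mul, Units.mul_inv, map_one]
    simp only [Set.mem_ofPred_eq] at *
    rcases hg with hg | hg
    · left
      rwa [hg, one_mul] at h
    · right
      rw [hg] at h
      linarith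

end EDDegree

end

noncomputable section

namespace EDDegree

/-! A Lagrange multiplier turns criticality at `x` with `det x = c` into `(u - x)ᵗ x = l • 1` for
some complex `l` (`forall_trace_eq_zero_iff`, `IsDetGroup.mem_criticalPoints_iff`). For this it must
be known that the complex points and tangent spaces are those of the level sets of `det`, which
rests on the Zariski density of the real matrices of determinant `c` (`aeval_eq_zero_of_det_eq`).
The equation is compatible with orthogonal multiplication on both sides, so the singular value
decomposition reduces to `u = diag(d)`. If the `d i ^ 2` are distinct, every solution commutes with
`diag(d) ^ 2`, hence is diagonal. What remains is the system `x i ^ 2 - d i * x i + l = 0` for all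
`i`, `∏ i, x i = c`, in the unknowns `x` and `l`.

To eliminate `x`, take the Kronecker product of the companion matrices of the quadratics. Its
eigenvalues are the `2 ^ n` products of one root from each quadratic, so `det (c - ⊗ Q_i)`, as a
polynomial in `l`, vanishes exactly at the admissible `l` (`elim_eq_prod`). With weights 1, n, 2 for
`d`, `c`, `l` it is homogeneous of weight `n * 2 ^ n` and contains a pure power of `l`, so its
degree in `l` is `n * 2 ^ (n - 1)` (`natDegree_elimPoly`). If it is separable, each root carries
exactly one solution (`eq_of_separable_elimPoly`). This gives the count for `SL`; for `SLpm` the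
determinants `1` and `-1` contribute equally.

Separability is the nonvanishing of a discriminant, so a single example makes it generic in `d`. The
example comes from reading the eliminant as a characteristic polynomial in `c`, where squarefreeness
is easy to arrange, and then exchanging `c` and `l` by Gauss's lemma (`exists_separable_elimPoly`).
An integrality argument converts genericity in the singular values `d` into genericity in `u`
(`exists_generic_matrix`). -/

open Polynomial

/-! ### Kronecker products of families of matrices -/

section PiKron

variable {ι κ A B : Type*} [Fintype ι] [CommRing A] [CommRing B]

/-- The Kronecker product of a finite family of square matrices. -/
def piKron (M : ι → Matrix κ κ A) : Matrix (ι → κ) (ι → κ) A :=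
  Matrix.of fun s t => ∏ i, M i (s i) (t i)

lemma piKron_mul [DecidableEq ι] [Fintype κ] (M N : ι → Matrix κ κ A) :
    piKron M * piKron N = piKron fun i => M i * N i := by
  ext s t
  simp only [piKron, Matrix.mul_apply, Matrix.of_apply, ← Finset.prod_mul_distrib]
  rw [Finset.prod_univ_sum, Fintype.piFinset_univ]

lemma piKron_one [DecidableEq κ] : piKron (fun _ : ι => (1 : Matrix κ κ A)) = 1 := by
  ext s t
  simp only [piKron, Matrix.of_apply, Matrix.one_apply]
  rw [Finset.prod_ite_zero, Finset.prod_const_one]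
  simp [funext_iff]

lemma piKron_map (f : A →+* B) (M : ι → Matrix κ κ A) :
    (piKron M).map f = piKron fun i => (M i).map f := by
  ext s t
  simp [piKron]

lemma piKron_mulVec [DecidableEq ι] [Fintype κ] (M : ι → Matrix κ κ A) (v : ι → κ → A) :
    (piKron M).mulVec (fun s => ∏ i, v i (s i)) =
      fun s => ∏ i, (M i).mulVec (v i) (s i) := by
  ext s
  simp only [piKron, Matrix.mulVec, dotProduct, Matrix.of_apply, ← Finset.prod_mul_distrib]
  rw [Finset.prod_univ_sum, Fintype.piFinset_univ]

/-- The Kronecker product is triangular for the lexicographic order: if `t` precedes `s`, some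
coordinate has `t i < s i`, and that factor of the entry vanishes. -/
lemma det_sub_piKron_of_upperTriangular {n : ℕ} [Fintype κ] [LinearOrder κ]
    (M : Fin n → Matrix κ κ A) (hM : ∀ i, (M i).BlockTriangular id) (c : A) :
    (Matrix.diagonal (fun _ => c) - piKron M).det = ∏ s : Fin n → κ, (c - ∏ i, M i (s i) (s i)) := by
  have h : (Matrix.diagonal (fun _ => c) - piKron M).BlockTriangular
      (fun s : Fin n → κ => toLex s) := by
    intro s t hst
    have hne : s ≠ t := by rintro rfl; exact lt_irrefl _ hst
    have : ∃ i, t i < s i := by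
      by_contra! hle
      exact absurd hst (not_lt.2 (Pi.toLex_monotone hle))
    obtain ⟨i, hi⟩ := this
    rw [Matrix.sub_apply, Matrix.diagonal_apply_ne _ hne, piKron, Matrix.of_apply,
      Finset.prod_eq_zero (Finset.mem_univ i) (hM i hi), sub_zero]
  have h2 := Matrix.det_of_isUpperTriangular (M := Matrix.reindex toLex toLex
    (Matrix.diagonal (fun _ => c) - piKron M)) (by
      intro s t hst
      exact h hst)
  rw [Matrix.det_reindex_self] at h2
  rw [h2, ← Equiv.prod_comp (toLex : (Fin n → κ) ≃ _)]
  simp [piKron]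

end PiKron

/-! ### The eliminant -/

section Elim

variable {n : ℕ} {A B : Type*} [CommRing A] [CommRing B]

/-- The matrix of multiplication by `x` on `A[x] / (x² - d x + l)`. -/
def quadMatrix (d l : A) : Matrix (Fin 2) (Fin 2) A := !![0, 1; -l, d]

/-- The eliminant of the unknowns `x i` from the system `x i ^ 2 - d i * x i + l = 0`,
`∏ i, x i = c`. -/
def elim (d : Fin n → A) (c l : A) : A :=
  (Matrix.diagonal (fun _ => c) - piKron fun i => quadMatrix (d i) l).det

lemma map_elim (f : A →+* B) (d : Fin n → A) (c l : A) :
    f (elim d c l) = elim (fun i => f (d i)) (f c) (f l) := by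
  rw [elim, RingHom.map_det, RingHom.mapMatrix_apply, Matrix.map_sub f (map_sub f), piKron_map,
    Matrix.diagonal_map (map_zero f), elim]
  congr 3
  ext i a b
  fin_cases a <;> fin_cases b <;> simp [quadMatrix]

/-- Each companion matrix is conjugate, by a unipotent matrix, to a triangular one with diagonal `x
i`, `y i`. Triangularizing instead of diagonalizing keeps this valid over any commutative ring and
for double roots. -/
lemma elim_eq_prod (d : Fin n → A) (c l : A) (x y : Fin n → A)
    (hd : ∀ i, x i + y i = d i) (hl : ∀ i, x i * y i = l) :
    elim d c l = ∏ s : Fin n → Fin 2, (c - ∏ i, ![x i, y i] (s i)) := by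
  set P : Fin n → Matrix (Fin 2) (Fin 2) A := fun i => !![1, 0; x i, 1] with hP
  set Q : Fin n → Matrix (Fin 2) (Fin 2) A := fun i => !![1, 0; -x i, 1] with hQ
  set T : Fin n → Matrix (Fin 2) (Fin 2) A := fun i => !![x i, 1; 0, y i] with hT
  have hPQ : piKron P * piKron Q = 1 := by
    rw [piKron_mul, ← piKron_one]
    congr 1
    ext i a b
    fin_cases a <;> fin_cases b <;> simp [hP, hQ, Matrix.mul_apply, Fin.sum_univ_two]
  have hPTQ : piKron P * piKron T * piKron Q = piKron fun i => quadMatrix (d i) l := by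
    rw [piKron_mul, piKron_mul]
    congr 1
    ext i a b
    fin_cases a <;> fin_cases b <;>
      simp [hP, hQ, hT, quadMatrix, Matrix.mul_apply, Fin.sum_univ_two, ← hd i, ← hl i]
    ring
  have hc : (Matrix.diagonal (fun _ => c) - piKron fun i => quadMatrix (d i) l) =
      piKron P * (Matrix.diagonal (fun _ => c) - piKron T) * piKron Q := by
    rw [Matrix.mul_sub, Matrix.sub_mul, hPTQ]
    congr 1
    rw [← Matrix.smul_one_eq_diagonal]
    simp [hPQ]
  have hdet : (piKron P).det * (piKron Q).det = 1 := by
    rw [← Matrix.det_mul, hPQ, Matrix.det_one]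
  rw [elim, hc, Matrix.det_mul, Matrix.det_mul, mul_right_comm, hdet, one_mul,
    det_sub_piKron_of_upperTriangular]
  · refine Finset.prod_congr rfl fun s _ => ?_
    congr 1
    refine Finset.prod_congr rfl fun i _ => ?_
    generalize s i = a
    fin_cases a <;> simp [hT]
  · intro i a b hab
    fin_cases a <;> fin_cases b <;> simp_all

/-- `(1, x i)` is an eigenvector of the companion matrix for the root `x i`, and tensors of
eigenvectors are eigenvectors. -/
lemma elim_mulVec (d : Fin n → A) (l : A) (x : Fin n → A)
    (hx : ∀ i, x i ^ 2 - d i * x i + l = 0) :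
    (piKron fun i => quadMatrix (d i) l).mulVec (fun s => ∏ i, ![1, x i] (s i)) =
      (∏ i, x i) • fun s => ∏ i, ![1, x i] (s i) := by
  rw [piKron_mulVec (fun i => quadMatrix (d i) l) (fun i => ![1, x i])]
  ext s
  simp only [Pi.smul_apply, smul_eq_mul, ← Finset.prod_mul_distrib]
  refine Finset.prod_congr rfl fun i _ => ?_
  generalize s i = a
  fin_cases a
  · simp [quadMatrix, Matrix.mulVec, dotProduct]
  · simp [quadMatrix, Matrix.mulVec, dotProduct]
    linear_combination - hx i

end Elim

/-! ### Kernel vectors and multiple roots of determinants -/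

/-- A square matrix with kernel of dimension at least two has zero adjugate. -/
lemma adjugate_eq_zero_of_mulVec_eq_zero {ι K : Type*} [Fintype ι] [DecidableEq ι] [Field K]
    (N : Matrix ι ι K) (v w : ι → K) (hvw : LinearIndependent K ![v, w])
    (hv : N.mulVec v = 0) (hw : N.mulVec w = 0) : N.adjugate = 0 := by
  ext i j
  rw [Matrix.adjugate_apply, Matrix.zero_apply, ← Matrix.exists_mulVec_eq_zero_iff]
  rw [LinearIndependent.pair_iff] at hvw
  -- An adjugate entry is the determinant of `N` with row `j` replaced by a unit vector; a kernel
  -- vector of `N` with vanishing coordinate `i` is still killed. A two-dimensional kernel contains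
  -- a nonzero such vector.
  have key : ∀ z : ι → K, N.mulVec z = 0 → z i = 0 →
      (N.updateRow j (Pi.single i 1)).mulVec z = 0 := by
    intro z hz hzi
    ext k
    by_cases hk : k = j
    · subst hk
      simp [Matrix.mulVec, Matrix.updateRow_self, hzi]
    · have := congrFun hz k
      simpa [Matrix.mulVec, Matrix.updateRow_ne hk] using this
  by_cases h0 : v i = 0
  · refine ⟨v, ?_, key v hv h0⟩
    rintro rfl
    simpa using (hvw 1 0 (by simp)).1
  · refine ⟨w i • v - v i • w, ?_, key _ ?_ ?_⟩
    · intro h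
      have := hvw (w i) (-v i) (by rw [neg_smul, ← sub_eq_add_neg, h])
      exact h0 (neg_eq_zero.1 this.2)
    · rw [Matrix.mulVec_sub, Matrix.mulVec_smul, Matrix.mulVec_smul, hv, hw]; simp
    · simp [mul_comm]

/-- If a polynomial matrix has two independent constant kernel vectors at `a`, then its
determinant does not have a simple root there. -/
lemma sq_dvd_det_of_mulVec_eq_zero {ι K : Type*} [Fintype ι] [DecidableEq ι] [Field K]
    (N : Matrix ι ι K[X]) (a : K) (v w : ι → K) (hvw : LinearIndependent K ![v, w])
    (hv : (N.map (eval a)).mulVec v = 0) (hw : (N.map (eval a)).mulVec w = 0) :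
    (X - C a) ^ 2 ∣ N.det := by
  have hadj := adjugate_eq_zero_of_mulVec_eq_zero _ v w hvw hv hw
  have hv0 : v ≠ 0 := hvw.ne_zero 0
  obtain ⟨k, hk⟩ : ∃ k, v k ≠ 0 := by
    by_contra! h
    exact hv0 (funext h)
  have hadj' : ∀ i j, (X - C a) ∣ N.adjugate i j := by
    intro i j
    rw [dvd_iff_isRoot]
    have h := RingHom.map_adjugate (evalRingHom a) N
    have h2 : (N.adjugate.map (eval a)) = 0 := by
      rw [← hadj]; exact h
    exact congrFun (congrFun h2 i) j
  have hNv : ∀ i, (X - C a) ∣ N.mulVec (fun j => C (v j)) i := by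
    intro i
    rw [dvd_iff_isRoot]
    have := congrFun hv i
    simpa [Matrix.mulVec, dotProduct, eval_finsetSum, IsRoot] using this
  -- In `adj N * (N v)` both factors are divisible by `X - a`, while the product is `det N` times
  -- `v`.
  have h : (N.adjugate * N).mulVec (fun j => C (v j)) k = N.det * C (v k) := by
    rw [Matrix.adjugate_mul]
    simp [Matrix.smul_mulVec]
  rw [← Matrix.mulVec_mulVec] at h
  have h3 : (X - C a) ^ 2 ∣ N.det * C (v k) := by
    rw [← h, sq]
    exact Finset.dvd_sum fun j _ => mul_dvd_mul (hadj' k j) (hNv j)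
  have hu : IsUnit (C (v k)) := isUnit_C.2 hk.isUnit
  exact (IsUnit.dvd_mul_right hu).1 h3

/-! ### Degree of the eliminant and count of diagonal solutions -/

section ElimPoly

variable {n : ℕ}

/-- The eliminant as a polynomial in the common product `l` of the roots. -/
def elimPoly {A : Type*} [CommRing A] (d : Fin n → A) (c : A) : A[X] :=
  elim (fun i => C (d i)) (C c) X

lemma eval_elimPoly {A : Type*} [CommRing A] (d : Fin n → A) (c l : A) :
    (elimPoly d c).eval l = elim d c l := by
  have := map_elim (evalRingHom l) (fun i => C (d i)) (C c) X
  simpa [elimPoly] using this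

lemma elimPoly_map {A B : Type*} [CommRing A] [CommRing B] (f : A →+* B) (d : Fin n → A) (c : A) :
    (elimPoly d c).map f = elimPoly (fun i => f (d i)) (f c) := by
  have := map_elim (mapRingHom f) (fun i => C (d i)) (C c) X
  simpa [elimPoly] using this

lemma exists_add_eq_mul_eq (d l : ℂ) : ∃ x y : ℂ, x + y = d ∧ x * y = l := by
  obtain ⟨s, hs⟩ := IsAlgClosed.exists_pow_nat_eq (d ^ 2 / 4 - l) (n := 2) (by norm_num)
  exact ⟨d / 2 + s, d / 2 - s, by ring, by linear_combination - hs⟩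

lemma exists_roots (d : Fin n → ℂ) (l : ℂ) :
    ∃ x y : Fin n → ℂ, (∀ i, x i + y i = d i) ∧ ∀ i, x i * y i = l := by
  choose x y h using fun i => exists_add_eq_mul_eq (d i) l
  exact ⟨x, y, fun i => (h i).1, fun i => (h i).2⟩

/-- Weighted homogeneity: scaling all roots by `t` scales `d`, `c`, `l` by `t`, `t ^ n`, `t ^ 2`,
and each of the `2 ^ n` factors by `t ^ n`. -/
lemma elim_smul (d : Fin n → ℂ) (c l t : ℂ) :
    elim (fun i => t * d i) (t ^ n * c) (t ^ 2 * l) = (t ^ n) ^ 2 ^ n * elim d c l := by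
  obtain ⟨x, y, hd, hl⟩ := exists_roots d l
  rw [elim_eq_prod d c l x y hd hl,
    elim_eq_prod (fun i => t * d i) _ _ (fun i => t * x i) (fun i => t * y i)
      (fun i => by rw [← hd i]; ring) (fun i => by rw [← hl i]; ring)]
  have h2 : (t ^ n) ^ 2 ^ n = ∏ _s : Fin n → Fin 2, t ^ n := by simp
  rw [h2, ← Finset.prod_mul_distrib]
  refine Finset.prod_congr rfl fun s _ => ?_
  rw [mul_sub]
  congr 1
  have h3 : t ^ n = ∏ _i : Fin n, t := by simp
  rw [h3, ← Finset.prod_mul_distrib]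
  refine Finset.prod_congr rfl fun i _ => ?_
  generalize s i = a
  fin_cases a <;> simp

/-- `q` is `p` with its coefficients reversed in degree `k`, so `q.eval 0` is the coefficient of
degree `k`. The proof compares orders of vanishing at 0. -/
lemma natDegree_eq_of_eval_eq {p q : ℂ[X]} {k : ℕ} (hq : q.eval 0 ≠ 0)
    (h : ∀ t : ℂ, t ≠ 0 → p.eval t⁻¹ * t ^ k = q.eval t) : p.natDegree = k := by
  have hp : p ≠ 0 := by
    rintro rfl
    have : q = 0 := by
      refine eq_zero_of_infinite_isRoot _ (Set.Infinite.mono ?_ (Set.finite_singleton (0:ℂ)).infinite_compl)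
      intro t ht
      simpa using (h t ht).symm
    simp [this] at hq
  have hrev : ∀ t : ℂ, t ≠ 0 → p.eval t⁻¹ * t ^ p.natDegree = p.reverse.eval t := by
    intro t ht
    have : Invertible t⁻¹ := invertibleOfNonzero (inv_ne_zero ht)
    have h1 := eval₂_reverse_mul_pow (RingHom.id ℂ) t⁻¹ p
    simp only [invOf_eq_inv, inv_inv] at h1
    change eval t p.reverse * _ = eval t⁻¹ p at h1
    rw [← h1, mul_assoc, ← mul_pow, inv_mul_cancel₀ ht, one_pow, mul_one]
  have hpoly : p.reverse * X ^ k = q * X ^ p.natDegree := by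
    rw [← sub_eq_zero]
    refine eq_zero_of_infinite_isRoot _ (Set.Infinite.mono ?_ (Set.finite_singleton (0:ℂ)).infinite_compl)
    intro t ht
    have ht' : t ≠ 0 := ht
    simp only [Set.mem_ofPred_eq, IsRoot.def, eval_sub, eval_mul, eval_pow, eval_X]
    rw [← h t ht', ← hrev t ht']
    ring
  have hq0 : q ≠ 0 := by rintro rfl; simp at hq
  have h0 : p.reverse.coeff 0 ≠ 0 := by simpa using hp
  have hr0 : p.reverse ≠ 0 := by simpa using hp
  have := congrArg natTrailingDegree hpoly
  rw [natTrailingDegree_mul_X_pow hr0, natTrailingDegree_mul_X_pow hq0,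
    natTrailingDegree_eq_zero_of_constantCoeff_ne_zero (by simpa using hp),
    natTrailingDegree_eq_zero_of_constantCoeff_ne_zero
      (by simpa [constantCoeff_apply, coeff_zero_eq_eval_zero] using hq)] at this
  omega

/-- By homogeneity, `l = -t⁻²` can be traded for `l = -1` with `d`, `c` scaled by `t`, `t ^ n`. At
`t = 0` the quadratics become `x ^ 2 = 1` and `c = 0`, so every factor is `±1`. Substituting `-X ^
2` doubles the degree. -/
lemma natDegree_elimPoly (hn : 1 ≤ n) (d : Fin n → ℂ) (c : ℂ) :
    (elimPoly d c).natDegree = n * 2 ^ (n - 1) := by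
  have h : ((elimPoly d c).comp (-X ^ 2)).natDegree = n * 2 ^ n := by
    refine natDegree_eq_of_eval_eq
      (q := elim (fun i => C (d i) * X) (C c * X ^ n) (-1)) ?_ ?_
    · have h1 := map_elim (evalRingHom 0) (fun i => C (d i) * X) (C c * X ^ n) (-1)
      simp only [coe_evalRingHom] at h1
      rw [h1, elim_eq_prod _ _ _ (fun _ => 1) (fun _ => -1) (by simp) (by simp),
        Finset.prod_ne_zero_iff]
      intro s _
      have h0 : eval 0 (C c * X ^ n) = 0 := by
        simp [show n ≠ 0 by omega]
      rw [h0, zero_sub, neg_ne_zero, Finset.prod_ne_zero_iff]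
      intro i _
      generalize s i = a
      fin_cases a <;> simp
    · intro t ht
      have h1 := map_elim (evalRingHom t) (fun i => C (d i) * X) (C c * X ^ n) (-1)
      simp only [coe_evalRingHom] at h1
      have h2 := elim_smul d c (-t⁻¹ ^ 2) t
      rw [h1, eval_comp, eval_elimPoly, mul_comm, pow_mul]
      simp only [eval_neg, eval_pow, eval_X, eval_mul, eval_C, eval_one]
      rw [← h2]
      congr 1
      · ext i; ring
      · ring
      · rw [inv_pow, mul_neg, mul_inv_cancel₀ (pow_ne_zero 2 ht)]
  rw [natDegree_comp, natDegree_neg, natDegree_X_pow] at h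
  obtain ⟨k, rfl⟩ : ∃ k, n = k + 1 := ⟨n - 1, by omega⟩
  rw [pow_succ, ← mul_assoc] at h
  simpa using h

/-- The diagonal critical points. -/
def solutions (d : Fin n → ℂ) (c : ℂ) : Set (Fin n → ℂ) :=
  {x | (∃ l, ∀ i, x i ^ 2 - d i * x i + l = 0) ∧ ∏ i, x i = c}

lemma isRoot_elimPoly_iff (d : Fin n → ℂ) (c l : ℂ) :
    (elimPoly d c).IsRoot l ↔
      ∃ x : Fin n → ℂ, (∀ i, x i ^ 2 - d i * x i + l = 0) ∧ ∏ i, x i = c := by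
  obtain ⟨x, y, hd, hl⟩ := exists_roots d l
  rw [IsRoot.def, eval_elimPoly, elim_eq_prod d c l x y hd hl, Finset.prod_eq_zero_iff]
  constructor
  · rintro ⟨s, -, hs⟩
    refine ⟨fun i => ![x i, y i] (s i), fun i => ?_, (sub_eq_zero.1 hs).symm⟩
    dsimp only
    rw [← hd i, ← hl i]
    generalize s i = a
    fin_cases a <;> simp <;> ring
  · rintro ⟨z, hz, hc⟩
    have h : ∀ i, ∃ a : Fin 2, z i = ![x i, y i] a := by
      intro i
      have : (z i - x i) * (z i - y i) = 0 := by
        rw [← hz i, ← hd i, ← hl i]; ring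
      rcases mul_eq_zero.1 this with h | h
      · exact ⟨0, by simpa [sub_eq_zero] using h⟩
      · exact ⟨1, by simpa [sub_eq_zero] using h⟩
    choose s hs using h
    exact ⟨s, Finset.mem_univ _, by rw [sub_eq_zero, ← hc]; exact Finset.prod_congr rfl fun i _ => hs i⟩

/-- The coordinate at `0` is 1 for both tensors, and the coordinate at the `j`-th unit vector
recovers `x j`, respectively `y j`. -/
lemma linearIndependent_tensor {x y : Fin n → ℂ} (hxy : x ≠ y) :
    LinearIndependent ℂ ![fun s : Fin n → Fin 2 => ∏ i, ![1, x i] (s i),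
      fun s : Fin n → Fin 2 => ∏ i, ![1, y i] (s i)] := by
  rw [LinearIndependent.pair_iff]
  intro a b hab
  obtain ⟨j, hj⟩ := Function.ne_iff.1 hxy
  have h0 := congrFun hab 0
  have h1 := congrFun hab (Pi.single j 1)
  have hs : ∀ z : Fin n → ℂ, ∏ i, ![1, z i] ((Pi.single j 1 : Fin n → Fin 2) i) = z j := by
    intro z
    rw [Finset.prod_eq_single j]
    · simp
    · intro i _ hi; simp [hi]
    · simp
  simp only [Pi.add_apply, Pi.smul_apply, smul_eq_mul, hs, Pi.zero_apply] at h0 h1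
  simp only [Matrix.cons_val_zero, Finset.prod_const_one, mul_one] at h0
  have ha : a * (x j - y j) = 0 := by linear_combination h1 - y j * h0
  have ha0 : a = 0 := (mul_eq_zero.1 ha).resolve_right (sub_ne_zero.2 hj)
  exact ⟨ha0, by simpa [ha0] using h0⟩

/-- Two solutions with the same `l` would give two independent kernel vectors of `c - ⊗ Q_i`, hence
a double root of the eliminant at `l`. -/
lemma eq_of_separable_elimPoly {d : Fin n → ℂ} {c l : ℂ} (hsep : (elimPoly d c).Separable)
    {x y : Fin n → ℂ} (hx : ∀ i, x i ^ 2 - d i * x i + l = 0) (hxc : ∏ i, x i = c)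
    (hy : ∀ i, y i ^ 2 - d i * y i + l = 0) (hyc : ∏ i, y i = c) : x = y := by
  by_contra hxy
  have key : ∀ z : Fin n → ℂ, (∀ i, z i ^ 2 - d i * z i + l = 0) → ∏ i, z i = c →
      ((Matrix.diagonal (fun _ => C c) -
        piKron fun i => quadMatrix (C (d i)) (X : ℂ[X])).map (eval l)).mulVec
          (fun s => ∏ i, ![1, z i] (s i)) = 0 := by
    intro z hz hc
    have h1 : (Matrix.diagonal (fun _ => C c) -
        piKron fun i => quadMatrix (C (d i)) (X : ℂ[X])).map (eval l) =
        Matrix.diagonal (fun _ => c) - piKron fun i => quadMatrix (d i) l := by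
      change Matrix.map _ (evalRingHom l) = _
      rw [Matrix.map_sub _ (map_sub _), piKron_map, Matrix.diagonal_map (map_zero _)]
      congr 2
      · ext; simp
      · ext i a b
        fin_cases a <;> fin_cases b <;> simp [quadMatrix]
    rw [h1, Matrix.sub_mulVec, elim_mulVec d l z hz, hc, ← Matrix.smul_one_eq_diagonal,
      Matrix.smul_mulVec, Matrix.one_mulVec, sub_self]
  have hdvd := sq_dvd_det_of_mulVec_eq_zero _ l _ _ (linearIndependent_tensor hxy)
    (key x hx hxc) (key y hy hyc)
  have := hsep.squarefree (X - C l) (by rw [← sq]; exact hdvd)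
  exact not_isUnit_X_sub_C l this

/-- A solution determines its multiplier through any one coordinate, which gives a bijection onto
the roots of the eliminant. -/
lemma encard_solutions (hn : 1 ≤ n) {d : Fin n → ℂ} {c : ℂ} (hsep : (elimPoly d c).Separable) :
    (solutions d c).encard = (n * 2 ^ (n - 1) : ℕ) := by
  classical
  have hroots : ((elimPoly d c).roots.toFinset : Set ℂ).encard = (n * 2 ^ (n - 1) : ℕ) := by
    rw [Set.encard_coe_eq_coe_finsetCard, Multiset.toFinset_card_of_nodup (nodup_roots hsep),
      IsAlgClosed.card_roots_eq_natDegree, natDegree_elimPoly hn]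
  rw [← hroots]
  set i₀ : Fin n := ⟨0, hn⟩
  have hl : ∀ (x : Fin n → ℂ) (l : ℂ), (∀ i, x i ^ 2 - d i * x i + l = 0) →
      l = d i₀ * x i₀ - x i₀ ^ 2 := fun x l h => by linear_combination h i₀
  refine Set.encard_congr (Set.BijOn.equiv (fun x => d i₀ * x i₀ - x i₀ ^ 2) ⟨?_, ?_, ?_⟩)
  · rintro x ⟨⟨l, hx⟩, hc⟩
    simp only [Finset.mem_coe, Multiset.mem_toFinset]
    rw [mem_roots hsep.ne_zero, isRoot_elimPoly_iff, ← hl x l hx]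
    exact ⟨x, hx, hc⟩
  · rintro x ⟨⟨l, hx⟩, hc⟩ y ⟨⟨l', hy⟩, hc'⟩ h
    simp only [← hl x l hx, ← hl y l' hy] at h
    subst h
    exact eq_of_separable_elimPoly hsep hx hc hy hc'
  · intro l h
    simp only [Finset.mem_coe, Multiset.mem_toFinset] at h
    rw [mem_roots hsep.ne_zero, isRoot_elimPoly_iff] at h
    obtain ⟨x, hx, hc⟩ := h
    exact ⟨x, ⟨⟨l, hx⟩, hc⟩, (hl x l hx).symm⟩

end ElimPoly

/-! ### Squarefreeness, fraction fields and specialization -/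

/-- A squarefree polynomial stays squarefree over the fraction field. -/
lemma squarefree_map_fractionRing {A K : Type*} [CommRing A] [IsDomain A] [NormalizedGCDMonoid A]
    [Field K] [Algebra A K] [IsFractionRing A K] {p : A[X]}
    (hsq : Squarefree p) : Squarefree (p.map (algebraMap A K)) := by
  intro q hq
  have hp0 : p.map (algebraMap A K) ≠ 0 :=
    (Polynomial.map_ne_zero_iff (IsFractionRing.injective A K)).2 hsq.ne_zero
  have hq0 : q ≠ 0 := by
    rintro rfl
    exact hp0 (by simpa using hq)
  obtain ⟨c, c0, hc⟩ := IsLocalization.integerNormalization_spec (nonZeroDivisors A) q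
  have hcu : IsUnit (C (algebraMap A K c)) :=
    isUnit_C.2 (IsUnit.mk0 _ (IsFractionRing.to_map_ne_zero_of_mem_nonZeroDivisors c0))
  set r := IsLocalization.integerNormalization (nonZeroDivisors A) q with hr
  have hrq : r.map (algebraMap A K) = C (algebraMap A K c) * q := by
    rw [hc, algebra_compatible_smul K, smul_eq_C_mul]
  have hr0 : r ≠ 0 := by
    intro h
    rw [h, Polynomial.map_zero] at hrq
    exact mul_ne_zero hcu.ne_zero hq0 hrq.symm
  have hcont : IsUnit (C (algebraMap A K r.content)) := by
    refine isUnit_C.2 (IsUnit.mk0 _ ?_)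
    rw [Ne, map_eq_zero_iff _ (IsFractionRing.injective A K), content_eq_zero_iff]
    exact hr0
  -- Over the fraction field, `q` may be replaced by a primitive polynomial over `A`; Gauss's lemma
  -- then brings the divisibility down to `A`.
  have hass : Associated (r.primPart.map (algebraMap A K)) q := by
    have h1 : r.map (algebraMap A K) =
        C (algebraMap A K r.content) * r.primPart.map (algebraMap A K) := by
      conv_lhs => rw [r.eq_C_content_mul_primPart]
      rw [Polynomial.map_mul, map_C]
    have h2 : C (algebraMap A K r.content) * r.primPart.map (algebraMap A K) =
        C (algebraMap A K c) * q := by rw [← h1, hrq]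
    exact (associated_unit_mul_left _ _ hcont).symm.trans
      ((Associated.of_eq h2).trans (associated_unit_mul_left _ _ hcu))
  have hdvd : (r.primPart * r.primPart).map (algebraMap A K) ∣ p.map (algebraMap A K) := by
    rw [Polynomial.map_mul]
    exact (hass.mul_mul hass).dvd.trans hq
  have := hsq _ ((r.isPrimitive_primPart.mul r.isPrimitive_primPart).dvd_of_fraction_map_dvd_fraction_map
    hdvd)
  exact hass.isUnit (this.map (mapRingHom (algebraMap A K)))

/-- If a monic polynomial with polynomial coefficients is squarefree at one value of the
parameter, then it is squarefree. -/
lemma squarefree_of_squarefree_map_eval {p : ℂ[X][X]} (hp : p.Monic) (a : ℂ)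
    (h : Squarefree (p.map (evalRingHom a))) : Squarefree p := by
  intro q hq
  have hlead : IsUnit q.leadingCoeff :=
    isUnit_of_dvd_one (hp.leadingCoeff ▸ leadingCoeff_dvd_leadingCoeff (dvd_of_mul_right_dvd hq))
  have hu := h (q.map (evalRingHom a)) (by
    rw [← Polynomial.map_mul]
    exact Polynomial.map_dvd _ hq)
  have hdeg : (q.map (evalRingHom a)).natDegree = q.natDegree :=
    natDegree_map_of_leadingCoeff_ne_zero _ (hlead.map (evalRingHom a)).ne_zero
  rw [natDegree_eq_zero_of_isUnit hu] at hdeg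
  rw [eq_C_of_natDegree_eq_zero hdeg.symm]
  rw [leadingCoeff, ← hdeg] at hlead
  exact hlead.map C

/-- A squarefree bivariate polynomial has separable specializations. -/
lemma exists_separable_map_eval {p : ℂ[X][X]} (hsq : Squarefree p) :
    ∃ a : ℂ, a ≠ 0 ∧ (p.map (evalRingHom a)).Separable := by
  classical
  let _ : NormalizedGCDMonoid ℂ[X] := Classical.choice inferInstance
  have hK := squarefree_map_fractionRing (K := FractionRing ℂ[X]) hsq
  rw [← PerfectField.separable_iff_squarefree] at hK
  obtain ⟨u, v, huv⟩ := hK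
  obtain ⟨c, c0, hc⟩ :=
    IsLocalization.integerNormalization_spec (nonZeroDivisors ℂ[X]) u
  obtain ⟨e, e0, he⟩ :=
    IsLocalization.integerNormalization_spec (nonZeroDivisors ℂ[X]) v
  set U := IsLocalization.integerNormalization (nonZeroDivisors ℂ[X]) u
  set W := IsLocalization.integerNormalization (nonZeroDivisors ℂ[X]) v
  -- The Bézout identity over the fraction field, with denominators cleared.
  have hid : C e * U * p + C c * W * derivative p = C (c * e) := by
    apply Polynomial.map_injective _ (IsFractionRing.injective ℂ[X] (FractionRing ℂ[X]))
    simp only [Polynomial.map_add, Polynomial.map_mul, map_C, hc, he, ← derivative_map]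
    rw [algebra_compatible_smul (FractionRing ℂ[X]) c, algebra_compatible_smul (FractionRing ℂ[X]) e,
      smul_eq_C_mul, smul_eq_C_mul, map_mul, C_mul]
    linear_combination C (algebraMap ℂ[X] (FractionRing ℂ[X]) c) *
      C (algebraMap ℂ[X] (FractionRing ℂ[X]) e) * huv
  -- The extra factor `X` forces `a ≠ 0`.
  have hce : c * e * X ≠ 0 :=
    mul_ne_zero (mul_ne_zero (nonZeroDivisors.ne_zero c0) (nonZeroDivisors.ne_zero e0)) X_ne_zero
  obtain ⟨a, ha⟩ : ∃ a, (c * e * X).eval a ≠ 0 := by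
    by_contra! h
    exact hce (Polynomial.funext (by simpa using h))
  simp only [eval_mul, eval_X, mul_ne_zero_iff] at ha
  refine ⟨a, ha.2, ?_⟩
  have hmap := congrArg (Polynomial.map (evalRingHom a)) hid
  simp only [Polynomial.map_add, Polynomial.map_mul, map_C, ← derivative_map, coe_evalRingHom,
    eval_mul] at hmap
  have hne : eval a c * eval a e ≠ 0 := mul_ne_zero ha.1.1 ha.1.2
  refine ⟨C (eval a c * eval a e)⁻¹ * (C (eval a e) * U.map (evalRingHom a)),
    C (eval a c * eval a e)⁻¹ * (C (eval a c) * W.map (evalRingHom a)), ?_⟩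
  have hinv : C (eval a c * eval a e)⁻¹ * C (eval a c * eval a e) = 1 := by
    rw [← C_mul, inv_mul_cancel₀ hne, C_1]
  linear_combination C (eval a c * eval a e)⁻¹ * hmap + hinv



/-! ### Data with separable eliminant -/

section

variable {n : ℕ}

/-- After multiplication by `∏ 2 ^ 2 ^ i` the product is a power of 4 whose exponent has the binary
digits of `{i | s i = 0}`; binary expansions are unique. -/
lemma prod_two_pow_ne {s t : Fin n → Fin 2} (hst : s ≠ t) :
    ∏ i : Fin n, ![(2 : ℂ) ^ 2 ^ (i : ℕ), ((2 : ℂ) ^ 2 ^ (i : ℕ))⁻¹] (s i) ≠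
      ∏ i : Fin n, ![(2 : ℂ) ^ 2 ^ (i : ℕ), ((2 : ℂ) ^ 2 ^ (i : ℕ))⁻¹] (t i) := by
  have key : ∀ s : Fin n → Fin 2,
      (∏ i : Fin n, (2 : ℂ) ^ 2 ^ (i : ℕ)) *
        ∏ i : Fin n, ![(2 : ℂ) ^ 2 ^ (i : ℕ), ((2 : ℂ) ^ 2 ^ (i : ℕ))⁻¹] (s i) =
      ((4 ^ ∑ i ∈ (Finset.univ.filter fun i => s i = 0).map Fin.valEmbedding, 2 ^ i : ℕ) : ℂ) := by
    intro s
    rw [← Finset.prod_mul_distrib, Finset.sum_map, ← Finset.prod_pow_eq_pow_sum, Finset.prod_filter]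
    push_cast
    refine Finset.prod_congr rfl fun i _ => ?_
    generalize s i = a
    fin_cases a
    · simp only [Fin.zero_eta, Matrix.cons_val_zero, if_true, Fin.valEmbedding_apply]
      rw [← mul_pow]; norm_num
    · simp
  intro h
  have h2 := key s
  rw [h, key t, Nat.cast_inj] at h2
  have h3 := Nat.pow_right_injective (le_refl 2 |>.trans (by norm_num)) h2
  have h4 := Finset.map_injective _ (Finset.geomSum_injective (le_refl 2) h3)
  refine hst (funext fun i => ?_)
  have h5 : t i = 0 ↔ s i = 0 := by
    have := Finset.ext_iff.1 h4 i
    simpa using this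
  omega

lemma squarefree_prod_X_sub_C {ι : Type*} [Fintype ι] (f : ι → ℂ) (hf : Function.Injective f) :
    Squarefree (∏ i, (X - C (f i))) :=
  ((separable_prod_X_sub_C_iff (f := f)).2 hf).squarefree

lemma squarefree_mulEquiv {M N : Type*} [Monoid M] [Monoid N] (e : M ≃* N) {x : M}
    (hx : Squarefree x) : Squarefree (e x) := by
  intro y hy
  have h := map_dvd e.symm hy
  rw [map_mul, e.symm_apply_apply] at h
  simpa using (hx _ h).map e

/-- The outer variable is `c` and the inner one `l`. In `c` this is a characteristic polynomial,
hence monic, so it suffices to look at `l = 1`, where roots `x i`, `(x i)⁻¹` with `x i = 2 ^ 2 ^ i`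
give distinct eigenvalues. -/
lemma exists_squarefree_elim :
    ∃ d : Fin n → ℂ, Squarefree (elim (fun i => C (C (d i))) X (C X) : ℂ[X][X]) := by
  set x : Fin n → ℂ := fun i => (2 : ℂ) ^ 2 ^ (i : ℕ) with hx
  set d : Fin n → ℂ := fun i => x i + (x i)⁻¹ with hd
  refine ⟨d, squarefree_of_squarefree_map_eval ?_ 1 ?_⟩
  · have : (elim (fun i => C (C (d i))) X (C X) : ℂ[X][X]) =
        (piKron fun i => quadMatrix (C (d i)) (X : ℂ[X])).charpoly := by
      rw [elim, Matrix.charpoly, Matrix.charmatrix, RingHom.mapMatrix_apply, piKron_map]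
      congr 2
      congr 1
      ext i a b
      fin_cases a <;> fin_cases b <;> simp [quadMatrix]
    rw [this]
    exact Matrix.charpoly_monic _
  · have h1 := map_elim (mapRingHom (evalRingHom (1 : ℂ))) (fun i => C (C (d i))) X (C X)
    simp only [coe_mapRingHom, map_C, coe_evalRingHom, eval_C, map_X, eval_X] at h1
    rw [h1, elim_eq_prod (fun i => C (d i)) X (C 1) (fun i => C (x i)) (fun i => C (x i)⁻¹)
      (fun i => by rw [← C_add]) (fun i => by
        rw [← C_mul, mul_inv_cancel₀ (by simp [hx])])]
    have h2 : ∀ s : Fin n → Fin 2, ∏ i, ![C (x i), C (x i)⁻¹] (s i) =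
        C (∏ i, ![x i, (x i)⁻¹] (s i)) := by
      intro s
      rw [map_prod]
      refine Finset.prod_congr rfl fun i _ => ?_
      generalize s i = a
      fin_cases a <;> simp
    simp only [h2]
    exact squarefree_prod_X_sub_C (fun s : Fin n → Fin 2 => ∏ i, ![x i, (x i)⁻¹] (s i))
      fun s t hst => by_contra fun hne => prod_two_pow_ne hne hst

lemma swap_elim (d : Fin n → ℂ) :
    Bivariate.swap (R := ℂ) (elim (fun i => C (C (d i))) X (C X)) =
      elimPoly (fun i => C (d i)) X := by
  have := map_elim (Bivariate.swap (R := ℂ)).toRingEquiv.toRingHom (fun i => C (C (d i))) X (C X)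
  simpa only [elimPoly, RingEquiv.toRingHom_eq_coe, AlgEquiv.toRingEquiv_toRingHom,
    RingHom.coe_coe, Bivariate.swap_C_C, Bivariate.swap_X, Bivariate.swap_Y] using this

lemma separable_of_separable_comp_C_mul_X {K : Type*} [Field K] {p : K[X]} {a : K} (ha : a ≠ 0)
    (h : (p.comp (C a * X)).Separable) : p.Separable := by
  have hcomp : (C a * X : K[X]).comp (C a⁻¹ * X) = X := by
    simp only [mul_comp, C_comp, X_comp, ← mul_assoc, ← C_mul]
    rw [mul_inv_cancel₀ ha, C_1, one_mul]
  obtain ⟨u, v, huv⟩ := h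
  refine ⟨u.comp (C a⁻¹ * X), C a * v.comp (C a⁻¹ * X), ?_⟩
  have h3 := congrArg (fun q : K[X] => q.comp (C a⁻¹ * X)) huv
  simp only [add_comp, mul_comp, one_comp, derivative_comp, derivative_mul, derivative_C,
    derivative_X, zero_mul, zero_add, mul_one, C_comp, comp_assoc, X_comp] at h3
  have hx : C a * (C a⁻¹ * X) = (X : K[X]) := by
    rw [← mul_assoc, ← C_mul, mul_inv_cancel₀ ha, C_1, one_mul]
  rw [hx, comp_X, comp_X] at h3
  linear_combination h3

/-- The eliminant is separable for some data. -/
lemma exists_separable_elimPoly (hn : 1 ≤ n) (c : ℂ) (hc : c ≠ 0) :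
    ∃ d : Fin n → ℂ, (elimPoly d c).Separable := by
  obtain ⟨d, hd⟩ := exists_squarefree_elim (n := n)
  have hsq := squarefree_mulEquiv (Bivariate.swap (R := ℂ)).toMulEquiv hd
  change Squarefree (Bivariate.swap (R := ℂ) _) at hsq
  rw [swap_elim] at hsq
  obtain ⟨c₁, hc₁, hsep⟩ := exists_separable_map_eval hsq
  rw [elimPoly_map] at hsep
  simp only [coe_evalRingHom, eval_C, eval_X] at hsep
  -- Specialization controls only some nonzero `c₁`; rescaling `d` by `t` moves it to `t ^ n * c₁ =
  -- c`.
  obtain ⟨t, ht⟩ := IsAlgClosed.exists_pow_nat_eq (c / c₁) hn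
  have ht0 : t ≠ 0 := by
    rintro rfl
    rw [zero_pow (by omega)] at ht
    exact div_ne_zero hc hc₁ ht.symm
  refine ⟨fun i => t * d i, separable_of_separable_comp_C_mul_X (pow_ne_zero 2 ht0) ?_⟩
  have hcomp : (elimPoly (fun i => t * d i) c).comp (C (t ^ 2) * X) =
      C ((t ^ n) ^ 2 ^ n) * elimPoly d c₁ := by
    refine Polynomial.funext fun l => ?_
    simp only [eval_comp, eval_mul, eval_C, eval_X, eval_elimPoly]
    rw [← elim_smul, ht, div_mul_cancel₀ _ hc₁]
  rw [hcomp]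
  exact Separable.unit_mul (isUnit_C.2 (pow_ne_zero _ (pow_ne_zero _ ht0)).isUnit) hsep

end

/-! ### Genericity in the singular values and in the matrix -/

section Generic

variable {n : ℕ}

/-- For generic real data the eliminant is separable. -/
lemma exists_generic_separable (hn : 1 ≤ n) (c : ℝ) (hc : c ≠ 0) :
    ∃ G : MvPolynomial (Fin n) ℝ, G ≠ 0 ∧ ∀ d : Fin n → ℝ, MvPolynomial.eval d G ≠ 0 →
      (elimPoly (fun i => (d i : ℂ)) (c : ℂ)).Separable := by
  set m := n * 2 ^ (n - 1) with hm
  set P : (MvPolynomial (Fin n) ℝ)[X] :=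
    elimPoly (fun i => MvPolynomial.X i) (MvPolynomial.C c) with hP
  -- The eliminant has degree `m` for every `d`, so this resultant of fixed format commutes with
  -- specialization and detects separability.
  have key : ∀ d : Fin n → ℂ, MvPolynomial.aeval d (resultant P (derivative P) m (m - 1)) ≠ 0 ↔
      (elimPoly d (c : ℂ)).Separable := by
    intro d
    have h1 : P.map (MvPolynomial.aeval d : MvPolynomial (Fin n) ℝ →ₐ[ℝ] ℂ).toRingHom =
        elimPoly d (c : ℂ) := by
      rw [hP, elimPoly_map]
      simp
    have h2 := resultant_map_map P (derivative P) m (m - 1)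
      (MvPolynomial.aeval d : MvPolynomial (Fin n) ℝ →ₐ[ℝ] ℂ).toRingHom
    rw [← derivative_map, h1] at h2
    change _ = MvPolynomial.aeval d _ at h2
    have h3 := natDegree_elimPoly hn d (c : ℂ)
    have h4 : (derivative (elimPoly d (c : ℂ))).natDegree = m - 1 := by
      rw [natDegree_derivative, h3]
    have h6 : resultant (elimPoly d (c : ℂ)) (derivative (elimPoly d (c : ℂ))) m (m - 1) =
        resultant (elimPoly d (c : ℂ)) (derivative (elimPoly d (c : ℂ))) := by
      rw [h4, h3]
    rw [← h2, h6, Ne, resultant_eq_zero_iff, not_and_or, not_not]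
    have h5 : elimPoly d (c : ℂ) ≠ 0 := by
      rintro h
      rw [h, natDegree_zero] at h3
      have : 0 < n * 2 ^ (n - 1) := by positivity
      omega
    simp [h5, Separable]
  refine ⟨resultant P (derivative P) m (m - 1), ?_, ?_⟩
  · obtain ⟨d, hd⟩ := exists_separable_elimPoly hn (c : ℂ) (by exact_mod_cast hc)
    intro h
    exact (key d).2 hd (by rw [h, map_zero])
  · intro d hd
    refine (key _).1 fun h => hd ?_
    have := MvPolynomial.aeval_algebraMap_apply ℂ d (resultant P (derivative P) m (m - 1))
    simp only [Complex.coe_algebraMap] at this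
    change MvPolynomial.aeval (Complex.ofReal ∘ d) _ = 0 at h
    rw [this] at h
    simpa [MvPolynomial.aeval_eq_eval] using h

/-- A nonzero element integral over the image of `f` divides a nonzero element of the image. -/
lemma exists_dvd_map_of_isIntegralElem {A B : Type*} [CommRing A] [CommRing B] [IsDomain B]
    (f : A →+* B) {g : B} (hg : g ≠ 0) (hi : f.IsIntegralElem g) :
    ∃ t, f t ≠ 0 ∧ g ∣ f t := by
  have hi' : IsIntegral f.range g := by
    obtain ⟨p, hp, h⟩ := hi
    refine ⟨p.map f.rangeRestrict, hp.map _, ?_⟩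
    rw [eval₂_map]
    exact h
  have := Ideal.comap_ne_bot_of_integral_mem hg (Ideal.mem_span_singleton_self g) hi'
  obtain ⟨⟨_, t, rfl⟩, ht, ht0⟩ := Submodule.exists_mem_ne_zero_of_ne_bot this
  refine ⟨t, fun h => ht0 (Subtype.ext h), ?_⟩
  exact Ideal.mem_span_singleton.1 ht

/-- The substitution of the coefficients of `∏ (X - d j ^ 2)` for the variables. -/
def sqCoeff (n : ℕ) : MvPolynomial (Fin n) ℝ →ₐ[ℝ] MvPolynomial (Fin n) ℝ :=
  MvPolynomial.aeval fun k =>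
    (∏ j : Fin n, (X - C ((MvPolynomial.X j : MvPolynomial (Fin n) ℝ) ^ 2))).coeff k

/-- Each variable `X j` is a root of `∏ (T - X j ^ 2)` evaluated at `T ^ 2`, a monic polynomial with
coefficients in the image. -/
lemma isIntegralElem_sqCoeff (g : MvPolynomial (Fin n) ℝ) :
    (sqCoeff n).toRingHom.IsIntegralElem g := by
  induction g using MvPolynomial.induction_on with
  | C r =>
    have := (sqCoeff n).toRingHom.isIntegralElem_map (x := MvPolynomial.C r)
    simpa [sqCoeff] using this
  | add p q hp hq => exact hp.add _ hq
  | mul_X p j hp =>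
    refine hp.mul _ ?_
    set S : (MvPolynomial (Fin n) ℝ)[X] :=
      ∏ j : Fin n, (X - C ((MvPolynomial.X j : MvPolynomial (Fin n) ℝ) ^ 2)) with hS
    have hSmonic : S.Monic := monic_prod_of_monic _ _ fun j _ => monic_X_sub_C _
    have hSdeg : S.natDegree = n := by
      rw [hS, natDegree_finsetProd_X_sub_C_eq_card]; simp
    set Q : (MvPolynomial (Fin n) ℝ)[X] :=
      X ^ n + ∑ k : Fin n, C (MvPolynomial.X k) * X ^ (k : ℕ) with hQ
    have hQmonic : Q.Monic := by
      refine monic_X_pow_add ?_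
      refine (degree_sum_fin_lt (fun k : Fin n => (MvPolynomial.X k : MvPolynomial (Fin n) ℝ)))
    have hmap : Q.map (sqCoeff n).toRingHom = S := by
      conv_rhs => rw [hSmonic.as_sum, hSdeg, Finset.sum_range]
      simp only [hQ, Polynomial.map_add, Polynomial.map_pow, map_X, Polynomial.map_sum,
        Polynomial.map_mul, map_C]
      congr 1
      refine Finset.sum_congr rfl fun k _ => ?_
      congr 2
      simp [sqCoeff, hS]
    refine ⟨expand _ 2 Q, hQmonic.expand (by norm_num), ?_⟩
    rw [← eval_map, map_expand, hmap, expand_eval, hS, eval_prod]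
    exact Finset.prod_eq_zero (Finset.mem_univ j) (by simp)

/-- A generic condition on the singular values is implied by a generic condition on a matrix. -/
lemma exists_generic_matrix (G : MvPolynomial (Fin n) ℝ) (hG : G ≠ 0) :
    ∃ P : MvPolynomial (Fin n × Fin n) ℝ, P ≠ 0 ∧ ∀ (U : Matrix (Fin n) (Fin n) ℝ) (d : Fin n → ℝ),
      (U * U.transpose).charpoly = ∏ i, (X - C (d i ^ 2)) →
      MvPolynomial.eval (fun ij => U ij.1 ij.2) P ≠ 0 → MvPolynomial.eval d G ≠ 0 := by
  -- A nonzero multiple of `G` is a polynomial in the coefficients of `∏ (X - d j ^ 2)`, which are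
  -- those of the characteristic polynomial of `U * Uᵗ`, hence polynomials in the entries of `U`.
  obtain ⟨T, hT0, hT⟩ := exists_dvd_map_of_isIntegralElem _ hG (isIntegralElem_sqCoeff G)
  set M : Matrix (Fin n) (Fin n) (MvPolynomial (Fin n × Fin n) ℝ) :=
    Matrix.mvPolynomialX (Fin n) (Fin n) ℝ with hM
  set P : MvPolynomial (Fin n × Fin n) ℝ :=
    MvPolynomial.aeval (fun k : Fin n => (M * M.transpose).charpoly.coeff k) T with hP
  have key : ∀ (U : Matrix (Fin n) (Fin n) ℝ) (d : Fin n → ℝ),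
      (U * U.transpose).charpoly = ∏ i, (X - C (d i ^ 2)) →
      MvPolynomial.eval (fun ij => U ij.1 ij.2) P = MvPolynomial.eval d (sqCoeff n T) := by
    intro U d h
    rw [hP, sqCoeff, MvPolynomial.map_aeval, MvPolynomial.map_aeval]
    have hc : ∀ k : ℕ, MvPolynomial.eval (fun ij : Fin n × Fin n => U ij.1 ij.2)
        ((M * M.transpose).charpoly.coeff k) = MvPolynomial.eval d
          ((∏ j : Fin n, (X - C ((MvPolynomial.X j : MvPolynomial (Fin n) ℝ) ^ 2))).coeff k) := by
      intro k
      rw [← coeff_map, ← coeff_map, ← Matrix.charpoly_map, Matrix.map_mul, Matrix.transpose_map]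
      have hMU : M.map (MvPolynomial.eval fun ij : Fin n × Fin n => U ij.1 ij.2) = U := by
        ext i j; simp [hM]
      rw [hMU, h, Polynomial.map_prod]
      simp
    simp only [hc]
    congr 1
    ext r <;> simp
  refine ⟨P, ?_, ?_⟩
  · intro h0
    refine hT0 (MvPolynomial.funext fun d => ?_)
    -- Diagonal matrices realize every `d`, so `P = 0` would make the image of `T` vanish
    -- identically.
    have h := key (Matrix.diagonal d) d (by
      rw [Matrix.diagonal_transpose, Matrix.diagonal_mul_diagonal, Matrix.charpoly_diagonal]
      simp [sq])
    rw [h0, map_zero] at h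
    exact h.symm.trans (map_zero _).symm
  · intro U d h hne h0
    apply hne
    obtain ⟨r, hr⟩ := hT
    change sqCoeff n T = G * r at hr
    rw [key U d h, hr, map_mul, h0, zero_mul]

end Generic

/-! ### Reduction to diagonal data -/

section MatrixSolutions

variable {n : ℕ}

/-- The singular value decomposition of an invertible real matrix. -/
lemma exists_singular_value_decomposition (U : Matrix (Fin n) (Fin n) ℝ) (hU : U.det ≠ 0) :
    ∃ (O₁ O₂ : Matrix (Fin n) (Fin n) ℝ) (d : Fin n → ℝ),
      O₁.transpose * O₁ = 1 ∧ O₂.transpose * O₂ = 1 ∧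
      U = O₁ * Matrix.diagonal d * O₂.transpose ∧
      (U * U.transpose).charpoly = ∏ i, (X - C (d i ^ 2)) := by
  have hps := Matrix.posSemidef_self_mul_conjTranspose U
  have hA := hps.1
  rw [Matrix.conjTranspose_eq_transpose_of_trivial] at hps hA
  set O : Matrix (Fin n) (Fin n) ℝ := hA.eigenvectorUnitary.1 with hO
  set e := hA.eigenvalues with he
  have hOO : O.transpose * O = 1 := by
    have := (Matrix.mem_unitaryGroup_iff'.1 hA.eigenvectorUnitary.2)
    rwa [Matrix.star_eq_conjTranspose, Matrix.conjTranspose_eq_transpose_of_trivial] at this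
  have hOO' : O * O.transpose = 1 := mul_eq_one_comm.1 hOO
  have hspec : U * U.transpose = O * Matrix.diagonal e * O.transpose := by
    have := hA.spectral_theorem
    rw [Unitary.conjStarAlgAut_apply, Matrix.star_eq_conjTranspose,
      Matrix.conjTranspose_eq_transpose_of_trivial] at this
    exact this
  have he0 : ∀ i, 0 ≤ e i := fun i => hps.eigenvalues_nonneg i
  have hene : ∀ i, e i ≠ 0 := by
    have h := hA.det_eq_prod_eigenvalues
    rw [Matrix.det_mul, Matrix.det_transpose] at h
    have h2 : ∏ i, e i ≠ 0 := by
      intro h0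
      have h3 : U.det * U.det = 0 := h.trans (by simpa using h0)
      exact mul_ne_zero hU hU h3
    exact fun i => Finset.prod_ne_zero_iff.1 h2 i (Finset.mem_univ i)
  set d : Fin n → ℝ := fun i => √(e i) with hd
  have hd0 : ∀ i, d i ≠ 0 := fun i => by
    rw [hd]; exact (Real.sqrt_ne_zero (he0 i)).2 (hene i)
  have hd2 : ∀ i, d i ^ 2 = e i := fun i => Real.sq_sqrt (he0 i)
  have hdd : Matrix.diagonal d * Matrix.diagonal (fun i => (d i)⁻¹) = 1 := by
    rw [Matrix.diagonal_mul_diagonal, ← Matrix.diagonal_one]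
    congr 1; ext i; exact mul_inv_cancel₀ (hd0 i)
  -- The second factor is forced by `U = O * D * O₂ᵗ`, as `D` is invertible.
  refine ⟨O, U.transpose * O * Matrix.diagonal (fun i => (d i)⁻¹), d, hOO, ?_, ?_, ?_⟩
  · simp only [Matrix.transpose_mul, Matrix.transpose_transpose, Matrix.diagonal_transpose]
    calc _ = Matrix.diagonal (fun i => (d i)⁻¹) * (O.transpose * (U * U.transpose) * O) *
          Matrix.diagonal (fun i => (d i)⁻¹) := by simp only [Matrix.mul_assoc]
      _ = Matrix.diagonal (fun i => (d i)⁻¹) * ((O.transpose * O) * Matrix.diagonal e *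
          (O.transpose * O)) * Matrix.diagonal (fun i => (d i)⁻¹) := by
        rw [hspec]; simp only [Matrix.mul_assoc]
      _ = 1 := by
        rw [hOO, Matrix.one_mul, Matrix.mul_one, Matrix.diagonal_mul_diagonal,
          Matrix.diagonal_mul_diagonal, ← Matrix.diagonal_one]
        congr 1; ext i
        rw [← hd2 i]
        have := hd0 i
        field_simp
  · simp only [Matrix.transpose_mul, Matrix.transpose_transpose, Matrix.diagonal_transpose]
    calc U = (O * O.transpose) * U := by rw [hOO', Matrix.one_mul]
      _ = O * (Matrix.diagonal d * Matrix.diagonal (fun i => (d i)⁻¹)) * (O.transpose * U) := by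
        rw [hdd, Matrix.mul_one, Matrix.mul_assoc]
      _ = _ := by simp only [Matrix.mul_assoc]
  · rw [hA.charpoly_eq]
    simp [hd2, he]

/-- The critical points, as matrices, at a data matrix `U`, of given determinant. -/
def matrixSolutions (U : Matrix (Fin n) (Fin n) ℂ) (c : ℂ) : Set (Matrix (Fin n) (Fin n) ℂ) :=
  {X | X.det = c ∧ ∃ l : ℂ, (U - X).transpose * X = l • 1}

/-- Since `Y` is invertible, the relation also holds with its factors exchanged. Transposing both
gives `Yᵗ D = D Y` and `D Yᵗ = Y D`, so `Y` commutes with `D ^ 2`, whose diagonal entries are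
distinct. -/
lemma eq_diagonal_of_mul_eq_smul_one {d : Fin n → ℂ}
    (hd : ∀ i j, i ≠ j → d i ^ 2 ≠ d j ^ 2) {Y : Matrix (Fin n) (Fin n) ℂ} (hY : Y.det ≠ 0) {l : ℂ}
    (h : (Matrix.diagonal d - Y).transpose * Y = l • 1) :
    Y = Matrix.diagonal fun i => Y i i := by
  have hu : IsUnit Y.det := hY.isUnit
  have h' : Y * (Matrix.diagonal d - Y).transpose = l • 1 := by
    calc Y * (Matrix.diagonal d - Y).transpose
        = Y * ((Matrix.diagonal d - Y).transpose * Y) * Y⁻¹ := by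
          rw [Matrix.mul_assoc, Matrix.mul_assoc, Matrix.mul_nonsing_inv _ hu, Matrix.mul_one]
      _ = l • 1 := by
          rw [h, Matrix.mul_smul, Matrix.mul_one, Matrix.smul_mul, Matrix.mul_nonsing_inv _ hu]
  set D := Matrix.diagonal d with hD
  have hDt : D.transpose = D := Matrix.diagonal_transpose d
  rw [Matrix.transpose_sub, hDt, Matrix.sub_mul, sub_eq_iff_eq_add] at h
  rw [Matrix.transpose_sub, hDt, Matrix.mul_sub, sub_eq_iff_eq_add] at h'
  have e1 : Y.transpose * D = D * Y := by
    have := congrArg Matrix.transpose h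
    rw [Matrix.transpose_mul, hDt, Matrix.transpose_add, Matrix.transpose_mul,
      Matrix.transpose_transpose, Matrix.transpose_smul, Matrix.transpose_one, ← h] at this
    exact this
  have e2 : D * Y.transpose = Y * D := by
    have := congrArg Matrix.transpose h'
    rw [Matrix.transpose_mul, hDt, Matrix.transpose_add, Matrix.transpose_mul,
      Matrix.transpose_transpose, Matrix.transpose_smul, Matrix.transpose_one, ← h'] at this
    exact this
  have e3 : D * D * Y = Y * (D * D) := by
    rw [Matrix.mul_assoc, ← e1, ← Matrix.mul_assoc, e2, Matrix.mul_assoc]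
  rw [hD, Matrix.diagonal_mul_diagonal] at e3
  ext i j
  by_cases hij : i = j
  · subst hij; simp
  · rw [Matrix.diagonal_apply_ne _ hij]
    have := congrFun (congrFun e3 i) j
    rw [Matrix.diagonal_mul, Matrix.mul_diagonal] at this
    have h0 : (d i ^ 2 - d j ^ 2) * Y i j = 0 := by linear_combination this
    exact (mul_eq_zero.1 h0).resolve_left (sub_ne_zero.2 (hd i j hij))

lemma diagonal_sub_mul_eq_iff (d x : Fin n → ℂ) (l : ℂ) :
    (Matrix.diagonal d - Matrix.diagonal x).transpose * Matrix.diagonal x = l • 1 ↔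
      ∀ i, x i ^ 2 - d i * x i + l = 0 := by
  rw [Matrix.diagonal_sub, Matrix.diagonal_transpose, Matrix.diagonal_mul_diagonal,
    Matrix.smul_one_eq_diagonal, Matrix.diagonal_injective.eq_iff, funext_iff]
  refine forall_congr' fun i => ⟨fun h => ?_, fun h => ?_⟩
  · linear_combination -h
  · linear_combination -h

/-- Orthogonal changes of coordinates preserve the Lagrange equation and multiply the determinant by
`det O₁ * det O₂ = ±1`. -/
lemma matrixSolutions_eq_image {d : Fin n → ℂ} (hd : ∀ i j, i ≠ j → d i ^ 2 ≠ d j ^ 2)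
    {O₁ O₂ : Matrix (Fin n) (Fin n) ℂ} (h₁ : O₁.transpose * O₁ = 1) (h₂ : O₂.transpose * O₂ = 1)
    {c : ℂ} (hc : c ≠ 0) :
    matrixSolutions (O₁ * Matrix.diagonal d * O₂.transpose) c =
      (fun x => O₁ * Matrix.diagonal x * O₂.transpose) ''
        solutions d (O₁.det * O₂.det * c) := by
  have h₁' : O₁ * O₁.transpose = 1 := mul_eq_one_comm.1 h₁
  have h₂' : O₂ * O₂.transpose = 1 := mul_eq_one_comm.1 h₂
  have hdet₁ : O₁.det * O₁.det = 1 := by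
    rw [← Matrix.det_one (n := Fin n), ← h₁, Matrix.det_mul, Matrix.det_transpose]
  have hdet₂ : O₂.det * O₂.det = 1 := by
    rw [← Matrix.det_one (n := Fin n), ← h₂, Matrix.det_mul, Matrix.det_transpose]
  have hconj : ∀ (Y : Matrix (Fin n) (Fin n) ℂ) (l : ℂ),
      (O₁ * Matrix.diagonal d * O₂.transpose - O₁ * Y * O₂.transpose).transpose *
        (O₁ * Y * O₂.transpose) = l • 1 ↔
      (Matrix.diagonal d - Y).transpose * Y = l • 1 := by
    intro Y l
    have e : (O₁ * Matrix.diagonal d * O₂.transpose - O₁ * Y * O₂.transpose).transpose *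
        (O₁ * Y * O₂.transpose) =
        O₂ * ((Matrix.diagonal d - Y).transpose * Y) * O₂.transpose := by
      rw [← Matrix.sub_mul, ← Matrix.mul_sub, Matrix.transpose_mul, Matrix.transpose_mul,
        Matrix.transpose_transpose]
      calc _ = O₂ * ((Matrix.diagonal d - Y).transpose * (O₁.transpose * O₁) * Y) *
            O₂.transpose := by simp only [Matrix.mul_assoc]
        _ = _ := by rw [h₁, Matrix.mul_one]
    rw [e]
    constructor
    · intro h
      calc (Matrix.diagonal d - Y).transpose * Y =
          (O₂.transpose * O₂) * ((Matrix.diagonal d - Y).transpose * Y) *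
            (O₂.transpose * O₂) := by rw [h₂, Matrix.one_mul, Matrix.mul_one]
        _ = O₂.transpose * (O₂ * ((Matrix.diagonal d - Y).transpose * Y) * O₂.transpose) * O₂ := by
          simp only [Matrix.mul_assoc]
        _ = l • 1 := by rw [h, Matrix.mul_smul, Matrix.mul_one, Matrix.smul_mul, h₂]
    · intro h
      rw [h, Matrix.mul_smul, Matrix.mul_one, Matrix.smul_mul, h₂']
  ext Z
  constructor
  · rintro ⟨hZ, l, hl⟩
    set Y := O₁.transpose * Z * O₂ with hY
    have hZY : Z = O₁ * Y * O₂.transpose := by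
      calc Z = (O₁ * O₁.transpose) * Z * (O₂ * O₂.transpose) := by
            rw [h₁', h₂', Matrix.one_mul, Matrix.mul_one]
        _ = _ := by simp only [hY, Matrix.mul_assoc]
    have hYdet : Y.det = O₁.det * O₂.det * c := by
      rw [hY, Matrix.det_mul, Matrix.det_mul, Matrix.det_transpose, hZ]; ring
    rw [hZY, hconj] at hl
    have hY0 : Y.det ≠ 0 := by
      rw [hYdet]
      exact mul_ne_zero (mul_ne_zero (left_ne_zero_of_mul_eq_one hdet₁)
        (left_ne_zero_of_mul_eq_one hdet₂)) hc
    have hdiag := eq_diagonal_of_mul_eq_smul_one hd hY0 hl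
    refine ⟨fun i => Y i i, ⟨⟨l, ?_⟩, ?_⟩, ?_⟩
    · rw [hdiag] at hl
      exact (diagonal_sub_mul_eq_iff _ _ _).1 hl
    · rw [← hYdet, ← Matrix.det_diagonal, ← hdiag]
    · change O₁ * Matrix.diagonal (fun i => Y i i) * O₂.transpose = Z
      rw [← hdiag, ← hZY]
  · rintro ⟨x, ⟨⟨l, hl⟩, hx⟩, rfl⟩
    refine ⟨?_, l, ?_⟩
    · rw [Matrix.det_mul, Matrix.det_mul, Matrix.det_transpose, Matrix.det_diagonal, hx]
      linear_combination c * O₂.det * O₂.det * hdet₁ + c * hdet₂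
    · exact (hconj _ _).2 ((diagonal_sub_mul_eq_iff _ _ _).2 hl)

lemma encard_matrixSolutions {d : Fin n → ℂ} (hd : ∀ i j, i ≠ j → d i ^ 2 ≠ d j ^ 2)
    {O₁ O₂ : Matrix (Fin n) (Fin n) ℂ} (h₁ : O₁.transpose * O₁ = 1) (h₂ : O₂.transpose * O₂ = 1)
    {c : ℂ} (hc : c ≠ 0) :
    (matrixSolutions (O₁ * Matrix.diagonal d * O₂.transpose) c).encard =
      (solutions d (O₁.det * O₂.det * c)).encard := by
  rw [matrixSolutions_eq_image hd h₁ h₂ hc]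
  refine Function.Injective.encard_image (fun x y hxy => ?_) _
  have key : ∀ z : Fin n → ℂ, O₁.transpose * (O₁ * Matrix.diagonal z * O₂.transpose) * O₂ =
      Matrix.diagonal z := by
    intro z
    calc _ = (O₁.transpose * O₁) * Matrix.diagonal z * (O₂.transpose * O₂) := by
          simp only [Matrix.mul_assoc]
      _ = _ := by rw [h₁, h₂, Matrix.one_mul, Matrix.mul_one]
  have h : O₁ * Matrix.diagonal x * O₂.transpose = O₁ * Matrix.diagonal y * O₂.transpose := hxy
  exact Matrix.diagonal_injective (by rw [← key x, h, key y])

/-- For generic real data, the number of critical points of determinant `1` and of determinant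
`-1`. -/
lemma exists_generic_encard_matrixSolutions (hn : 1 ≤ n) :
    ∃ P : MvPolynomial (Fin n × Fin n) ℝ, P ≠ 0 ∧ ∀ U : Matrix (Fin n) (Fin n) ℝ,
      MvPolynomial.eval (fun ij => U ij.1 ij.2) P ≠ 0 →
      (matrixSolutions (U.map Complex.ofReal) 1).encard = (n * 2 ^ (n - 1) : ℕ) ∧
      (matrixSolutions (U.map Complex.ofReal) (-1)).encard = (n * 2 ^ (n - 1) : ℕ) := by
  obtain ⟨G₁, hG₁, hsep₁⟩ := exists_generic_separable hn 1 one_ne_zero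
  obtain ⟨G₂, hG₂, hsep₂⟩ := exists_generic_separable hn (-1) (by norm_num)
  set G₃ : MvPolynomial (Fin n) ℝ := ∏ p ∈ Finset.univ.offDiag,
    (MvPolynomial.X p.1 ^ 2 - MvPolynomial.X p.2 ^ 2) with hG₃
  have hG₃0 : G₃ ≠ 0 := by
    rw [hG₃, Finset.prod_ne_zero_iff]
    rintro ⟨i, j⟩ hij h
    have hij : i ≠ j := by simpa using hij
    have := congrArg (MvPolynomial.eval (Pi.single i (1 : ℝ))) h
    simp [hij.symm] at this
  obtain ⟨P, hP, hPG⟩ := exists_generic_matrix (G₁ * G₂ * G₃) (mul_ne_zero (mul_ne_zero hG₁ hG₂) hG₃0)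
  set Δ : MvPolynomial (Fin n × Fin n) ℝ := (Matrix.mvPolynomialX (Fin n) (Fin n) ℝ).det with hΔ
  refine ⟨P * Δ, mul_ne_zero hP (Matrix.det_mvPolynomialX_ne_zero _ _), fun U hU => ?_⟩
  rw [map_mul, mul_ne_zero_iff] at hU
  have hdet : U.det ≠ 0 := by
    have : MvPolynomial.eval (fun ij : Fin n × Fin n => U ij.1 ij.2) Δ = U.det := by
      rw [hΔ, RingHom.map_det]
      congr 1
      ext i j; simp
    rw [← this]
    exact hU.2
  obtain ⟨O₁, O₂, d, h₁, h₂, hUd, hchar⟩ := exists_singular_value_decomposition U hdet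
  have hG := hPG U d hchar hU.1
  rw [map_mul, map_mul, mul_ne_zero_iff, mul_ne_zero_iff] at hG
  have hd : ∀ i j, i ≠ j → ((d i : ℂ)) ^ 2 ≠ (d j : ℂ) ^ 2 := by
    intro i j hij h
    apply hG.2
    rw [hG₃, map_prod]
    refine Finset.prod_eq_zero (i := (i, j)) (by simpa using hij) ?_
    have : d i ^ 2 = d j ^ 2 := by exact_mod_cast h
    simp [this]
  have hmap : U.map Complex.ofReal = O₁.map Complex.ofReal * Matrix.diagonal (fun i => (d i : ℂ)) *
      (O₂.map Complex.ofReal).transpose := by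
    conv_lhs => rw [hUd]
    change Matrix.map _ Complex.ofRealHom = _
    rw [Matrix.map_mul, Matrix.map_mul, Matrix.transpose_map, Matrix.diagonal_map (map_zero _)]
    rfl
  have horth : ∀ O : Matrix (Fin n) (Fin n) ℝ, O.transpose * O = 1 →
      (O.map Complex.ofReal).transpose * O.map Complex.ofReal = 1 := by
    intro O hO
    have := congrArg (fun M => Matrix.map M Complex.ofRealHom) hO
    simp only [Matrix.map_mul] at this
    rw [Matrix.transpose_map, Matrix.map_one _ (map_zero _) (map_one _)] at this
    exact this
  have hdetO : ∀ O : Matrix (Fin n) (Fin n) ℝ, O.transpose * O = 1 →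
      (O.map Complex.ofReal).det = 1 ∨ (O.map Complex.ofReal).det = -1 := by
    intro O hO
    have := congrArg Matrix.det (horth O hO)
    rw [Matrix.det_mul, Matrix.det_transpose, Matrix.det_one] at this
    exact mul_self_eq_one_iff.1 this
  -- The orthogonal factors may flip the sign of the determinant, so both signs are needed for
  -- either count.
  have hcount : ∀ c : ℂ, c = 1 ∨ c = -1 →
      (solutions (fun i => (d i : ℂ)) c).encard = (n * 2 ^ (n - 1) : ℕ) := by
    rintro c (rfl | rfl)
    · exact encard_solutions hn (by simpa using hsep₁ d hG.1.1)
    · exact encard_solutions hn (by simpa using hsep₂ d hG.1.2)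
  rw [hmap, encard_matrixSolutions hd (horth _ h₁) (horth _ h₂) one_ne_zero,
    encard_matrixSolutions hd (horth _ h₁) (horth _ h₂) (neg_ne_zero.2 one_ne_zero)]
  constructor <;> refine hcount _ ?_ <;>
    rcases hdetO _ h₁ with h | h <;> rcases hdetO _ h₂ with h' | h' <;> simp [h, h']

end MatrixSolutions

/-! ### Zariski density and tangent spaces of the level sets of det -/

section Density

variable {n : ℕ}

/-- The matrix `M` with column `k` multiplied by `s`. -/
def scaleCol (M : Matrix (Fin n) (Fin n) ℂ) (k : Fin n) (s : ℂ) : Matrix (Fin n) (Fin n) ℂ :=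
  M * Matrix.diagonal (Function.update 1 k s)

lemma scaleCol_apply (M : Matrix (Fin n) (Fin n) ℂ) (k : Fin n) (s : ℂ) (i j : Fin n) :
    scaleCol M k s i j = M i j * if j = k then s else 1 := by
  rw [scaleCol, Matrix.mul_diagonal, Function.update_apply]
  rfl

lemma det_scaleCol (M : Matrix (Fin n) (Fin n) ℂ) (k : Fin n) (s : ℂ) :
    (scaleCol M k s).det = M.det * s := by
  rw [scaleCol, Matrix.det_mul, Matrix.det_diagonal, Finset.prod_update_of_mem (Finset.mem_univ k)]
  simp

/-- The polynomial `det` in the matrix entries. -/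
def detPoly (n : ℕ) : MvPolynomial (Fin n × Fin n) ℝ := (Matrix.mvPolynomialX (Fin n) (Fin n) ℝ).det

lemma aeval_detPoly (M : Matrix (Fin n) (Fin n) ℂ) :
    MvPolynomial.aeval (fun ij => M ij.1 ij.2) (detPoly n) = M.det := by
  rw [detPoly, AlgHom.map_det]
  congr 1
  ext i j
  simp

lemma eval_detPoly (M : Matrix (Fin n) (Fin n) ℝ) :
    MvPolynomial.eval (fun ij => M ij.1 ij.2) (detPoly n) = M.det := by
  rw [detPoly, RingHom.map_det]
  congr 1
  ext i j
  simp

lemma aeval_map_ofReal (M : Matrix (Fin n) (Fin n) ℝ) (p : MvPolynomial (Fin n × Fin n) ℝ) :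
    MvPolynomial.aeval (fun ij => M.map Complex.ofReal ij.1 ij.2) p =
      (MvPolynomial.eval (fun ij => M ij.1 ij.2) p : ℂ) := by
  have := MvPolynomial.aeval_algebraMap_apply ℂ (fun ij : Fin n × Fin n => M ij.1 ij.2) p
  simpa [MvPolynomial.aeval_eq_eval, Function.comp_def] using this

/-- Scaling one column by `c / det M` retracts invertible matrices onto determinant `c`; only powers
of `det M` occur as denominators. -/
lemma exists_clear_denominators (k : Fin n) (c : ℝ) (p : MvPolynomial (Fin n × Fin n) ℝ) :
    ∃ (N : ℕ) (q : MvPolynomial (Fin n × Fin n) ℝ), ∀ M : Matrix (Fin n) (Fin n) ℂ, M.det ≠ 0 →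
      M.det ^ N * MvPolynomial.aeval (fun ij => scaleCol M k (c / M.det) ij.1 ij.2) p =
        MvPolynomial.aeval (fun ij => M ij.1 ij.2) q := by
  induction p using MvPolynomial.induction_on with
  | C r => exact ⟨0, MvPolynomial.C r, fun M _ => by simp⟩
  | add p₁ p₂ h₁ h₂ =>
    obtain ⟨N₁, q₁, h₁⟩ := h₁
    obtain ⟨N₂, q₂, h₂⟩ := h₂
    refine ⟨N₁ + N₂, detPoly n ^ N₂ * q₁ + detPoly n ^ N₁ * q₂, fun M hM => ?_⟩
    simp only [map_add, map_mul, map_pow, aeval_detPoly, ← h₁ M hM, ← h₂ M hM]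
    ring
  | mul_X p ij h =>
    obtain ⟨N, q, h⟩ := h
    refine ⟨N + 1, q * MvPolynomial.X ij * (if ij.2 = k then MvPolynomial.C c else detPoly n),
      fun M hM => ?_⟩
    rw [map_mul, map_mul, map_mul, MvPolynomial.aeval_X, MvPolynomial.aeval_X, scaleCol_apply,
      ← h M hM]
    split_ifs with hk
    · rw [MvPolynomial.aeval_C, Complex.coe_algebraMap]
      field_simp
      ring
    · rw [aeval_detPoly]
      ring

/-- The real matrices of determinant `c` are Zariski dense in the complex ones. -/
lemma aeval_eq_zero_of_det_eq (hn : 1 ≤ n) {c : ℝ} (hc : c ≠ 0)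
    {p : MvPolynomial (Fin n × Fin n) ℝ}
    (hp : ∀ M : Matrix (Fin n) (Fin n) ℝ, M.det = c →
      MvPolynomial.eval (fun ij => M ij.1 ij.2) p = 0)
    (M : Matrix (Fin n) (Fin n) ℂ) (hM : M.det = c) :
    MvPolynomial.aeval (fun ij => M ij.1 ij.2) p = 0 := by
  set k : Fin n := ⟨0, hn⟩
  obtain ⟨N, q, hq⟩ := exists_clear_denominators k c p
  -- The factor `detPoly n` absorbs the singular real matrices, where the scaling is undefined.
  have hq0 : q * detPoly n = 0 := by
    refine MvPolynomial.funext fun v => ?_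
    rw [map_zero, map_mul]
    set Y : Matrix (Fin n) (Fin n) ℝ := Matrix.of fun i j => v (i, j) with hY
    have hv : v = fun ij => Y ij.1 ij.2 := by ext ⟨i, j⟩; rfl
    rw [hv, eval_detPoly]
    by_cases h0 : Y.det = 0
    · rw [h0, mul_zero]
    have hdet : (Y.map Complex.ofReal).det = (Y.det : ℂ) :=
      (RingHom.map_det Complex.ofRealHom Y).symm
    have h1 := hq (Y.map Complex.ofReal) (by rw [hdet]; exact_mod_cast h0)
    set Z : Matrix (Fin n) (Fin n) ℝ :=
      Y * Matrix.diagonal (Function.update 1 k (c / Y.det)) with hZ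
    have hZY : scaleCol (Y.map Complex.ofReal) k (c / (Y.map Complex.ofReal).det) =
        Z.map Complex.ofReal := by
      ext i j
      rw [scaleCol_apply, hdet, hZ, Matrix.map_apply, Matrix.map_apply, Matrix.mul_diagonal,
        Function.update_apply]
      split_ifs <;> simp
    have hZdet : Z.det = c := by
      rw [hZ, Matrix.det_mul, Matrix.det_diagonal,
        Finset.prod_update_of_mem (Finset.mem_univ k)]
      simp [mul_div_cancel₀, h0]
    rw [hZY, aeval_map_ofReal, aeval_map_ofReal, hp Z hZdet, Complex.ofReal_zero, mul_zero] at h1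
    exact mul_eq_zero_of_left (Complex.ofReal_eq_zero.1 h1.symm) _
  have hq' : q = 0 :=
    (mul_eq_zero.1 hq0).resolve_right (Matrix.det_mvPolynomialX_ne_zero _ _)
  have hcC : (c : ℂ) ≠ 0 := by exact_mod_cast hc
  have h := hq M (by rw [hM]; exact hcC)
  have hs : scaleCol M k (c / M.det) = M := by
    rw [hM, div_self hcC, scaleCol]
    have : Function.update (1 : Fin n → ℂ) k 1 = 1 := Function.update_eq_self k 1
    rw [this]
    simp
  rw [hs, hq', map_zero, hM] at h
  exact (mul_eq_zero.1 h).resolve_left (pow_ne_zero _ hcC)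

/-- The derivative of a polynomial along a path depends only on the value and the velocity. -/
lemma exists_hasDerivAt_aeval {σ : Type*} {f g : ℂ → σ → ℂ} {v : σ → ℂ} {t : ℂ}
    (hfg : f t = g t) (hf : ∀ i, HasDerivAt (fun s => f s i) (v i) t)
    (hg : ∀ i, HasDerivAt (fun s => g s i) (v i) t) (p : MvPolynomial σ ℝ) :
    ∃ D, HasDerivAt (fun s => MvPolynomial.aeval (f s) p) D t ∧
      HasDerivAt (fun s => MvPolynomial.aeval (g s) p) D t := by
  induction p using MvPolynomial.induction_on with
  | C r => exact ⟨0, by simpa using hasDerivAt_const t (r : ℂ), by simpa using hasDerivAt_const t (r : ℂ)⟩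
  | add p q hp hq =>
    obtain ⟨D, h₁, h₂⟩ := hp
    obtain ⟨E, h₃, h₄⟩ := hq
    exact ⟨D + E, by simpa using h₁.fun_add h₃, by simpa using h₂.fun_add h₄⟩
  | mul_X p i hp =>
    obtain ⟨D, h₁, h₂⟩ := hp
    refine ⟨D * f t i + MvPolynomial.aeval (f t) p * v i, ?_, ?_⟩
    · simpa using h₁.fun_mul (hf i)
    · have := h₂.fun_mul (hg i)
      rw [← hfg] at this
      simpa using this

lemma hasDerivAt_det_one_add_smul (B : Matrix (Fin n) (Fin n) ℂ) :
    HasDerivAt (fun t : ℂ => (1 + t • B).det) B.trace 0 := by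
  have h : (fun t : ℂ => (1 + t • B).det) = fun t => 1 + B.trace * t +
      ((1 + (Polynomial.X : Polynomial ℂ) • B.map Polynomial.C).det.divX.divX).eval t * t ^ 2 := by
    ext t
    exact Matrix.det_one_add_smul t B
  rw [h]
  set q := (1 + (Polynomial.X : Polynomial ℂ) • B.map Polynomial.C).det.divX.divX
  have h1 : HasDerivAt (fun t : ℂ => 1 + B.trace * t) B.trace 0 := by
    simpa using ((hasDerivAt_id (0 : ℂ)).const_mul B.trace).const_add 1
  have h2 := (q.hasDerivAt 0).fun_mul (hasDerivAt_pow 2 (0 : ℂ))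
  simpa using h1.fun_add h2

lemma add_smul_eq_mul {X : Matrix (Fin n) (Fin n) ℂ} (hX : X.det ≠ 0)
    (A : Matrix (Fin n) (Fin n) ℂ) (t : ℂ) : X + t • A = X * (1 + t • (X⁻¹ * A)) := by
  rw [Matrix.mul_add, Matrix.mul_one, Matrix.mul_smul, ← Matrix.mul_assoc,
    Matrix.mul_nonsing_inv _ hX.isUnit, Matrix.one_mul]

lemma hasDerivAt_det {X : Matrix (Fin n) (Fin n) ℂ} (hX : X.det ≠ 0)
    (A : Matrix (Fin n) (Fin n) ℂ) :
    HasDerivAt (fun t : ℂ => (X + t • A).det) (X.det * (X⁻¹ * A).trace) 0 := by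
  simp only [add_smul_eq_mul hX, Matrix.det_mul]
  exact (hasDerivAt_det_one_add_smul _).const_mul _

/-- A polynomial vanishing on the matrices of determinant `det X` has zero derivative in the
directions `A` with `tr (X⁻¹ A) = 0`. -/
lemma deriv_aeval_eq_zero (hn : 1 ≤ n) {X : Matrix (Fin n) (Fin n) ℂ} (hX : X.det ≠ 0)
    {p : MvPolynomial (Fin n × Fin n) ℝ}
    (hp : ∀ M : Matrix (Fin n) (Fin n) ℂ, M.det = X.det →
      MvPolynomial.aeval (fun ij => M ij.1 ij.2) p = 0)
    {A : Matrix (Fin n) (Fin n) ℂ} (hA : (X⁻¹ * A).trace = 0) :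
    deriv (fun t : ℂ => MvPolynomial.aeval (fun ij => (X + t • A) ij.1 ij.2) p) 0 = 0 := by
  set k : Fin n := ⟨0, hn⟩
  set δ : ℂ → ℂ := fun t => (1 + t • (X⁻¹ * A)).det with hδ
  have hδ0 : δ 0 = 1 := by simp [hδ]
  have hδd : HasDerivAt δ 0 0 := hA ▸ hasDerivAt_det_one_add_smul (X⁻¹ * A)
  have hinv : HasDerivAt (fun t => (δ t)⁻¹) 0 0 := by
    simpa using hδd.fun_inv (by rw [hδ0]; exact one_ne_zero)
  have hlin : ∀ i j, HasDerivAt (fun t : ℂ => (X + t • A) i j) (A i j) 0 := by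
    intro i j
    simpa using ((hasDerivAt_id (0 : ℂ)).mul_const (A i j)).const_add (X i j)
  -- Dividing column `k` by `δ t` bends the line `X + t A` into the level set of `det`. As `δ` has
  -- value 1 and derivative 0 at 0, the velocity is unchanged.
  obtain ⟨D, h₁, h₂⟩ := exists_hasDerivAt_aeval (t := 0) (v := fun ij : Fin n × Fin n => A ij.1 ij.2)
    (f := fun t ij => (X + t • A) ij.1 ij.2)
    (g := fun t ij => scaleCol (X + t • A) k (δ t)⁻¹ ij.1 ij.2)
    (by ext ij; simp [scaleCol_apply, hδ0])
    (fun ij => hlin _ _)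
    (fun ij => by
      simp only [scaleCol_apply]
      split_ifs with h
      · have := (hlin ij.1 ij.2).fun_mul hinv
        simpa [hδ0] using this
      · simpa using hlin ij.1 ij.2) p
  have hev : (fun t => MvPolynomial.aeval
      (fun ij : Fin n × Fin n => scaleCol (X + t • A) k (δ t)⁻¹ ij.1 ij.2) p) =ᶠ[nhds 0]
      fun _ => (0 : ℂ) := by
    have hne : ∀ᶠ t in nhds 0, δ t ≠ 0 :=
      hδd.continuousAt.eventually_ne (by rw [hδ0]; exact one_ne_zero)
    filter_upwards [hne] with t ht
    apply hp
    rw [det_scaleCol, add_smul_eq_mul hX, Matrix.det_mul, mul_assoc]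
    change X.det * (δ t * (δ t)⁻¹) = X.det
    rw [mul_inv_cancel₀ ht, mul_one]
  have hD : D = 0 := h₂.unique ((hasDerivAt_const (0 : ℂ) (0 : ℂ)).congr_of_eventuallyEq hev)
  rw [h₁.deriv, hD]

/-- Orthogonality to the tangent space, by a Lagrange multiplier. -/
lemma forall_trace_eq_zero_iff (hn : 1 ≤ n) {X : Matrix (Fin n) (Fin n) ℂ} (hX : X.det ≠ 0)
    (W : Matrix (Fin n) (Fin n) ℂ) :
    (∀ A : Matrix (Fin n) (Fin n) ℂ, (X⁻¹ * A).trace = 0 → (W * A).trace = 0) ↔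
      ∃ l : ℂ, W * X = l • 1 := by
  constructor
  · intro h
    have h' : ∀ B : Matrix (Fin n) (Fin n) ℂ, B.trace = 0 → (W * X * B).trace = 0 := by
      intro B hB
      rw [Matrix.mul_assoc]
      refine h _ ?_
      rw [← Matrix.mul_assoc, Matrix.nonsing_inv_mul _ hX.isUnit, Matrix.one_mul, hB]
    set k : Fin n := ⟨0, hn⟩
    refine ⟨(W * X) k k, ?_⟩
    ext i j
    by_cases hij : i = j
    · subst hij
      have := h' (Matrix.single i i 1 - Matrix.single k k 1) (by simp)
      rw [Matrix.mul_sub, Matrix.trace_sub, Matrix.trace_mul_single, Matrix.trace_mul_single] at this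
      simpa [sub_eq_zero] using this
    · have := h' (Matrix.single j i 1) (by simp [Matrix.trace_single_eq_of_ne, Ne.symm hij])
      rw [Matrix.trace_mul_single] at this
      simpa [Matrix.one_apply_ne hij] using this
  · rintro ⟨l, hl⟩ A hA
    have : W = l • X⁻¹ := by
      calc W = W * X * X⁻¹ := by
            rw [Matrix.mul_assoc, Matrix.mul_nonsing_inv _ hX.isUnit, Matrix.mul_one]
        _ = l • X⁻¹ := by rw [hl, Matrix.smul_mul, Matrix.one_mul]
    rw [this, Matrix.smul_mul, Matrix.trace_smul, hA, smul_zero]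

end Density

/-! ### From endomorphisms to matrices -/

section Transfer

variable {V : Type*} [NormedAddCommGroup V] [InnerProductSpace ℝ V] {n : ℕ}
  (b : OrthonormalBasis (Fin n) ℝ V)

lemma complexMatrix_bijective : Function.Bijective (complexMatrix b) :=
  (LinearMap.toMatrix (b.toBasis.baseChange ℂ) (b.toBasis.baseChange ℂ)).bijective

lemma complexMatrix_add_smul (x a : Module.End ℂ (ℂ ⊗[ℝ] V)) (t : ℂ) :
    complexMatrix b (x + t • a) = complexMatrix b x + t • complexMatrix b a := by
  simp [complexMatrix]

lemma complexMatrix_baseChange_sub (u : Module.End ℝ V) (x : Module.End ℂ (ℂ ⊗[ℝ] V)) :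
    complexMatrix b (u.baseChange ℂ - x) =
      (realMatrix b u).map Complex.ofReal - complexMatrix b x := by
  rw [complexMatrix, map_sub]
  congr 1
  ext i j
  simp [realMatrix, LinearMap.toMatrix_apply, Module.Basis.baseChange_repr_tmul]

lemma isUnit_iff_det_complexMatrix_ne_zero (x : Module.End ℂ (ℂ ⊗[ℝ] V)) :
    IsUnit x ↔ (complexMatrix b x).det ≠ 0 := by
  rw [complexMatrix, LinearMap.det_toMatrix, ← isUnit_iff_ne_zero]
  have : Module.Finite ℂ (ℂ ⊗[ℝ] V) := Module.Finite.of_basis (b.toBasis.baseChange ℂ)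
  exact LinearMap.isUnit_iff_isUnit_det x

lemma det_realMatrix (x : Module.End ℝ V) : (realMatrix b x).det = LinearMap.det x :=
  LinearMap.det_toMatrix _ _

lemma exists_realMatrix_eq (M : Matrix (Fin n) (Fin n) ℝ) (hM : M.det ≠ 0) :
    ∃ g : LinearMap.GeneralLinearGroup ℝ V, realMatrix b (g : Module.End ℝ V) = M := by
  have : Module.Finite ℝ V := Module.Finite.of_basis b.toBasis
  have hx : realMatrix b (Matrix.toLin b.toBasis b.toBasis M) = M :=
    LinearMap.toMatrix_toLin _ _ _
  have hu : IsUnit (Matrix.toLin b.toBasis b.toBasis M) := by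
    rw [LinearMap.isUnit_iff_isUnit_det, ← det_realMatrix b, hx]
    exact hM.isUnit
  exact ⟨hu.unit, hx⟩

/-- A group of real points given by a condition on the determinant. -/
structure IsDetGroup (G : Subgroup (LinearMap.GeneralLinearGroup ℝ V)) (S : Set ℝ)
    (q : Polynomial ℝ) : Prop where
  mem_iff : ∀ g, g ∈ G ↔ LinearMap.det (g : Module.End ℝ V) ∈ S
  ne_zero : ∀ c ∈ S, c ≠ 0
  root_iff : ∀ z : ℂ, Polynomial.aeval z q = 0 ↔ ∃ c ∈ S, z = c
  deriv_ne_zero : ∀ c ∈ S, Polynomial.aeval (c : ℂ) (Polynomial.derivative q) ≠ 0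

variable {b} {G : Subgroup (LinearMap.GeneralLinearGroup ℝ V)} {S : Set ℝ} {q : Polynomial ℝ}

lemma IsDetGroup.mem_vanishing_iff (hG : IsDetGroup G S q) (p : MvPolynomial (Fin n × Fin n) ℝ) :
    p ∈ vanishing b G ↔ ∀ M : Matrix (Fin n) (Fin n) ℝ, M.det ∈ S →
      MvPolynomial.eval (fun ij => M ij.1 ij.2) p = 0 := by
  constructor
  · intro h M hM
    obtain ⟨g, rfl⟩ := exists_realMatrix_eq b M (hG.ne_zero _ hM)
    exact h g ((hG.mem_iff g).2 (by rwa [← det_realMatrix b]))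
  · intro h g hg
    exact h _ (by rw [det_realMatrix]; exact (hG.mem_iff g).1 hg)

lemma IsDetGroup.aeval_eq_zero (hn : 1 ≤ n) (hG : IsDetGroup G S q)
    {p : MvPolynomial (Fin n × Fin n) ℝ} (hp : p ∈ vanishing b G) {c : ℝ} (hc : c ∈ S)
    (M : Matrix (Fin n) (Fin n) ℂ) (hM : M.det = c) :
    MvPolynomial.aeval (fun ij => M ij.1 ij.2) p = 0 :=
  aeval_eq_zero_of_det_eq hn (hG.ne_zero c hc)
    (fun M hM => (hG.mem_vanishing_iff p).1 hp M (by rwa [hM])) M hM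

lemma aeval_aeval_detPoly (q : Polynomial ℝ) (M : Matrix (Fin n) (Fin n) ℂ) :
    MvPolynomial.aeval (fun ij => M ij.1 ij.2) (Polynomial.aeval (detPoly n) q) =
      Polynomial.aeval M.det q := by
  rw [← Polynomial.aeval_algHom_apply, aeval_detPoly]

lemma IsDetGroup.aeval_detPoly_mem_vanishing (hG : IsDetGroup G S q) :
    Polynomial.aeval (detPoly n) q ∈ vanishing b G := by
  rw [hG.mem_vanishing_iff]
  intro M hM
  have h := aeval_aeval_detPoly q (M.map Complex.ofReal)
  rw [aeval_map_ofReal] at h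
  have hdet : (M.map Complex.ofReal).det = (M.det : ℂ) :=
    (RingHom.map_det Complex.ofRealHom M).symm
  rw [hdet, (hG.root_iff _).2 ⟨_, hM, rfl⟩] at h
  exact_mod_cast h

/-- `q ∘ det` vanishes on `G` and confines the determinant to `S`; the converse is the density of
real points in each level set. -/
lemma IsDetGroup.mem_complexPoints_iff (hn : 1 ≤ n) (hG : IsDetGroup G S q)
    (x : Module.End ℂ (ℂ ⊗[ℝ] V)) :
    x ∈ complexPoints b G ↔ ∃ c ∈ S, (complexMatrix b x).det = c := by
  constructor
  · rintro ⟨-, h⟩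
    have := h _ hG.aeval_detPoly_mem_vanishing
    rw [complexEval, aeval_aeval_detPoly] at this
    exact (hG.root_iff _).1 this
  · rintro ⟨c, hc, h⟩
    refine ⟨?_, fun p hp => hG.aeval_eq_zero hn hp hc _ h⟩
    rw [isUnit_iff_det_complexMatrix_ne_zero b, h]
    exact_mod_cast hG.ne_zero c hc

/-- The roots of `q` in `S` are simple, so the differential of `q ∘ det` is a nonzero multiple of
`tr (X⁻¹ A)`. Conversely, no polynomial vanishing on `G` imposes a further condition. -/
lemma IsDetGroup.mem_tangentSpace_iff (hn : 1 ≤ n) (hG : IsDetGroup G S q)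
    {x : Module.End ℂ (ℂ ⊗[ℝ] V)} {c : ℝ} (hc : c ∈ S) (hx : (complexMatrix b x).det = c)
    (a : Module.End ℂ (ℂ ⊗[ℝ] V)) :
    a ∈ tangentSpace b G x ↔ ((complexMatrix b x)⁻¹ * complexMatrix b a).trace = 0 := by
  have hc0 : (c : ℂ) ≠ 0 := by exact_mod_cast hG.ne_zero c hc
  have hx0 : (complexMatrix b x).det ≠ 0 := by rwa [hx]
  constructor
  · intro h
    have h1 := h _ hG.aeval_detPoly_mem_vanishing
    simp only [complexEval, complexMatrix_add_smul, aeval_aeval_detPoly] at h1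
    have h2 := hasDerivAt_det hx0 (complexMatrix b a)
    have h3 : HasDerivAt (fun z : ℂ => Polynomial.aeval z q)
        (Polynomial.aeval (c : ℂ) (Polynomial.derivative q))
        (complexMatrix b x + (0 : ℂ) • complexMatrix b a).det := by
      rw [zero_smul, add_zero, hx]
      exact q.hasDerivAt_aeval (c : ℂ)
    have h4 := (h3.comp 0 h2).deriv
    simp only [Function.comp_def] at h4
    rw [h1] at h4
    exact (mul_eq_zero.1 ((mul_eq_zero.1 h4.symm).resolve_left (hG.deriv_ne_zero c hc))).resolve_left
      hx0
  · intro h p hp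
    simp only [complexEval, complexMatrix_add_smul]
    exact deriv_aeval_eq_zero hn hx0
      (fun M hM => hG.aeval_eq_zero hn hp hc M (hM.trans hx)) h

lemma IsDetGroup.mem_criticalPoints_iff (hn : 1 ≤ n) (hG : IsDetGroup G S q)
    (u : Module.End ℝ V) (x : Module.End ℂ (ℂ ⊗[ℝ] V)) :
    x ∈ criticalPoints b G u ↔ ∃ c ∈ S,
      complexMatrix b x ∈ matrixSolutions ((realMatrix b u).map Complex.ofReal) (c : ℂ) := by
  have key : ∀ c ∈ S, (complexMatrix b x).det = (c : ℂ) →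
      ((∀ a ∈ tangentSpace b G x, frobeniusForm b (u.baseChange ℂ - x) a = 0) ↔
        ∃ l : ℂ, ((realMatrix b u).map Complex.ofReal - complexMatrix b x).transpose *
          complexMatrix b x = l • 1) := by
    intro c hc hx
    have hx0 : (complexMatrix b x).det ≠ 0 := by
      rw [hx]; exact_mod_cast hG.ne_zero c hc
    rw [← forall_trace_eq_zero_iff hn hx0, (complexMatrix_bijective b).surjective.forall]
    refine forall_congr' fun a => ?_
    rw [hG.mem_tangentSpace_iff hn hc hx, frobeniusForm, complexMatrix_baseChange_sub]
  constructor
  · rintro ⟨hx, ha⟩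
    obtain ⟨c, hc, h⟩ := (hG.mem_complexPoints_iff hn x).1 hx
    exact ⟨c, hc, h, (key c hc h).1 ha⟩
  · rintro ⟨c, hc, h, hl⟩
    exact ⟨(hG.mem_complexPoints_iff hn x).2 ⟨c, hc, h⟩, (key c hc h).2 hl⟩

lemma IsDetGroup.encard_criticalPoints (hn : 1 ≤ n) (hG : IsDetGroup G S q)
    (u : Module.End ℝ V) :
    (criticalPoints b G u).encard =
      (⋃ c ∈ S, matrixSolutions ((realMatrix b u).map Complex.ofReal) (c : ℂ)).encard := by
  have : criticalPoints b G u = complexMatrix b ⁻¹'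
      (⋃ c ∈ S, matrixSolutions ((realMatrix b u).map Complex.ofReal) (c : ℂ)) := by
    ext x
    simp [hG.mem_criticalPoints_iff hn]
  rw [this, Set.encard_preimage_of_bijective (complexMatrix_bijective b)]

lemma isDetGroup_SL : IsDetGroup (SL V) {1} (Polynomial.X - 1) where
  mem_iff _ := Iff.rfl
  ne_zero := by simp
  root_iff z := by simp [sub_eq_zero]
  deriv_ne_zero := by simp

lemma isDetGroup_SLpm : IsDetGroup (SLpm V) {1, -1} (Polynomial.X ^ 2 - 1) where
  mem_iff _ := Iff.rfl
  ne_zero := by simp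
  root_iff z := by simp [sub_eq_zero]
  deriv_ne_zero := by simp

end Transfer

end EDDegree

end

theorem mainTheorem1 {V : Type*} [NormedAddCommGroup V] [InnerProductSpace ℝ V]
    (n : ℕ) (hn : 1 ≤ n) (b : OrthonormalBasis (Fin n) ℝ V) :
    EDDegree.IsEDDegree b (EDDegree.SLpm V) (n * 2 ^ n) ∧
      EDDegree.IsEDDegree b (EDDegree.SL V) (n * 2 ^ (n - 1)) := by
  obtain ⟨P, hP, h⟩ := EDDegree.exists_generic_encard_matrixSolutions hn
  refine ⟨⟨P, hP, fun u hu => ?_⟩, ⟨P, hP, fun u hu => ?_⟩⟩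
  · obtain ⟨h₁, h₂⟩ := h (EDDegree.realMatrix b u) hu
    rw [EDDegree.isDetGroup_SLpm.encard_criticalPoints hn, Set.biUnion_pair, Set.encard_union_eq]
    · rw [Complex.ofReal_neg, Complex.ofReal_one, h₁, h₂, ← Nat.cast_add]
      obtain ⟨k, rfl⟩ : ∃ k, n = k + 1 := ⟨n - 1, by omega⟩
      congr 1
      rw [Nat.add_sub_cancel]
      ring
    · rw [Set.disjoint_left]
      rintro X ⟨hX, -⟩ ⟨hX', -⟩
      rw [hX] at hX'
      norm_num at hX'
  · obtain ⟨h₁, -⟩ := h (EDDegree.realMatrix b u) hu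
    rw [EDDegree.isDetGroup_SL.encard_criticalPoints hn, Set.biUnion_singleton,
      Complex.ofReal_one, h₁]
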